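/- **Consistency of the HDG method.** Let $\dim\in\{2,3\}$, $k\ge 1$, let $\mu,\kappa_f,\kappa_m,\sigma>0$ and $\alpha,\beta\in\mathbb R$. Let $\Omega,\Omega^s,\Omega^d\subset\mathbb R^{\dim}$ be open sets, each equal to the interior of its closure, with $\Omega^s\cap\Omega^d=\emptyset$ and $\overline\Omega=\overline\Omega^s\cup\overline\Omega^d$. Put $\Gamma^I=\overline\Omega^s\cap\overline\Omega^d$ and $\Gamma^j=\partial\Omega^j\cap\partial\Omega$ ($j=s,d$). Let $n^j$ be the outward unit normal of $\Omega^j$; let $n=n^s$ on $\Gamma^I$ and $n=n^d$ on $\Gamma^d$. Write $\epsilon(u)=(\nabla u+(\nabla u)^T)/2$ and $w^t=w-(w\cdot n)n$. Let $\mathcal T^j$ be a finite triangulation of $\overline\Omega^j$ by closed simplices such that $\mathcal T=\mathcal T^s\cup\mathcal T^d$ is conforming. Let $\mathcal F^j$ be the set of facets of the simplices in $\mathcal T^j$ and $\Gamma_0^j$ their union. Suppose that $(u,u^m,p,p^m)$, with $u^j=u|_{\Omega^j}$ and $p^j=p|_{\Omega^j}$, is a solution of the dual-porosity-Stokes problem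 with sources $f,g$ that is smooth in the sense that $u^s\in[H^2(\Omega^s)]^{\dim}$, $u^d,u^m\in[H^1(\Omega^d)]^{\dim}$, $p^s\in H^1(\Omega^s)$, $p^d,p^m\in H^1(\Omega^d)$, and that these functions and $\nabla u^s$ have traces in $L^2$ of the mesh skeleton $\Gamma_0^s$ or $\Gamma_0^d$ of their subdomain (automatic for Lipschitz subdomains; a trace is the $L^2$-limit of the restrictions of functions smooth on $\mathbb R^{\dim}$ that converge in $H^1$ of the subdomain). That is, almost everywhere (boundary values being traces): - in $\Omega^s$: $-\nabla\cdot(2\mu\epsilon(u))+\nabla p=f$ and $\nabla\cdot u=0$; on $\Gamma^s$: $u^s=0$; - in $\Omega^d$: $\kappa_f^{-1}u+\nabla p=0$, $\nabla\cdot u+\sigma\kappa_m(p-p^m)=g$, $\kappa_m^{-1}u^m+\nabla p^m=0$, $\nabla\cdot u^m+\sigma\kappa_m(p^m-p)=0$; on $\Gamma^d$: $u^m\cdot n=0$ and $u^d\cdot n=0$; - on $\Gamma^I$: $u^m\cdot n=0$, $u^s\cdot n=u^d\cdot n$, $-2\mu\,\epsilon(u^s)n\cdot n+p^s=p^d$,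 $-2\mu(\epsilon(u^s)n)^t=\alpha\mu\kappa_f^{-1/2}(u^s)^t$. Let $\bar u$ be the trace of $u^s$ on $\Gamma_0^s$, $\bar p^s$ the trace of $p^s$ on $\Gamma_0^s$, and $\bar p^d,\bar p^m$ the traces of $p^d,p^m$ on $\Gamma_0^d$. Then $\boldsymbol u=(u,\bar u,u^m)$ and $\boldsymbol p=(p,\bar p^s,\bar p^d,p^m,\bar p^m)$ satisfy $$a_h(\boldsymbol u,\boldsymbol v_h)+b_h(\boldsymbol p,\boldsymbol v_h)=(f,v_h)_{\Omega^s},\qquad b_h(\boldsymbol q_h,\boldsymbol u)-c_h(\boldsymbol p,\boldsymbol q_h)=-(g,q_h)_{\Omega^d}$$ for all $\boldsymbol v_h=(v_h,\bar v_h,v_h^m)$ and $\boldsymbol q_h=(q_h,\bar q_h^s,\bar q_h^d,q_h^m,\bar q_h^m)$ in the following discrete spaces: $v_h$ and $v_h^m$ are $\mathbb R^{\dim}$-valued functions on $\Omega$ and $\Omega^d$ that are polynomials of degree at most $k$ on each simplex of $\mathcal T$ and $\mathcal T^d$, respectively; $\bar v_h$ is an $\mathbb R^{\dim}$-valued function on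 $\Gamma_0^s$ that is a polynomial of degree at most $k$ on each $F\in\mathcal F^s$, with $\bar v_h=0$ on $\Gamma^s$; $q_h\in L^2_0(\Omega)$ and $q_h^m\in L^2_0(\Omega^d)$ (mean value zero) are polynomials of degree at most $k-1$ on each simplex; $\bar q_h^s$, and $\bar q_h^d,\bar q_h^m$, are polynomials of degree at most $k$ on each $F\in\mathcal F^s$, and $F\in\mathcal F^d$, respectively. Here $(\cdot,\cdot)_{\Omega^j}=\sum_{K\in\mathcal T^j}(\cdot,\cdot)_K$ and $\langle\cdot,\cdot\rangle_{\partial\mathcal T^j}=\sum_{K\in\mathcal T^j}\langle\cdot,\cdot\rangle_{\partial K}$ are sums of $L^2$-inner products, with derivatives taken elementwise; in $\langle\cdot,\cdot\rangle_{\partial K}$ the functions $u,v$ and their gradients stand for their traces from inside $K$, and $n$, $n^s$ stand for the outward unit normal of $K$. With $h_K$ the diameter of $K$, $$\begin{aligned} a_h(\boldsymbol u,\boldsymbol v)={}&(2\mu\epsilon(u),\epsilon(v))_{\Omega^s}-\langle2\mu\epsilon(u)n^s,v-\bar v\rangle_{\partial\mathcal T^s}-\langle2\mu\epsilon(v)n^s,u-\bar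 u\rangle_{\partial\mathcal T^s}\\ &+\sum_{K\in\mathcal T^s}2\beta\mu h_K^{-1}\langle u-\bar u,v-\bar v\rangle_{\partial K}+(\kappa_f^{-1}u,v)_{\Omega^d}+(\kappa_m^{-1}u^m,v^m)_{\Omega^d}+\langle\alpha\mu\kappa_f^{-1/2}\bar u^t,\bar v^t\rangle_{\Gamma^I},\\ b_h(\boldsymbol p,\boldsymbol v)={}&\sum_{j=s,d}\bigl[-(p,\nabla\cdot v)_{\Omega^j}+\langle\bar p^j,v\cdot n\rangle_{\partial\mathcal T^j}-\langle\bar p^j,\bar v\cdot n^j\rangle_{\Gamma^I}\bigr]-(p^m,\nabla\cdot v^m)_{\Omega^d}+\langle\bar p^m,v^m\cdot n\rangle_{\partial\mathcal T^d},\\ c_h(\boldsymbol p,\boldsymbol q)={}&\sigma\kappa_m(p^m-p,q^m-q)_{\Omega^d}. \end{aligned}$$ -/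

import Mathlib

open MeasureTheory Filter Topology
open scoped ContDiff

namespace DualPorosityStokes

/-- The ambient space `ℝ^d` with its Euclidean norm. -/
abbrev Pt (d : ℕ) : Type := EuclideanSpace ℝ (Fin d)

/-- The `j`-th partial derivative of a smooth scalar function. -/
noncomputable def partialDeriv {d : ℕ} (j : Fin d) (φ : Pt d → ℝ) (x : Pt d) : ℝ :=
  fderiv ℝ φ x (EuclideanSpace.single j 1)

/-- The surface measure: the `(d - 1)`-dimensional Hausdorff measure, normalised so that it agrees
with Lebesgue measure on hyperplanes. -/
noncomputable def surface (d : ℕ) : Measure (Pt d) :=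
  Measure.euclideanHausdorffMeasure (d - 1)

/-! ### Sobolev functions and traces -/

/-- `g` is the weak `j`-th partial derivative of `w` in the open set `Ω`. -/
def HasWeakPartial {d : ℕ} (Ω : Set (Pt d)) (j : Fin d) (w g : Pt d → ℝ) : Prop :=
  ∀ φ : Pt d → ℝ, ContDiff ℝ ∞ φ → HasCompactSupport φ → tsupport φ ⊆ Ω →
    ∫ x in Ω, w x * partialDeriv j φ x = - ∫ x in Ω, g x * φ x

/-- `w ∈ H¹(Ω)` with weak gradient `Dw`, where `Dw x j` is `∂_j w (x)`. -/
structure IsH1 {d : ℕ} (Ω : Set (Pt d)) (w : Pt d → ℝ) (Dw : Pt d → Fin d → ℝ) : Prop where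
  memLp : MemLp w 2 (volume.restrict Ω)
  memLp_grad : ∀ j, MemLp (fun x => Dw x j) 2 (volume.restrict Ω)
  weak : ∀ j, HasWeakPartial Ω j w (fun x => Dw x j)

/-- `τ` is the trace on `Γ ⊆ closure Ω` of the function `w ∈ H¹(Ω)` with weak gradient `Dw`.
The trace operator is the continuous extension of `φ ↦ φ|_Γ` from functions that are smooth up
to the boundary: `τ` is the limit in `L²(Γ)` of the restrictions to `Γ` of smooth functions that
converge to `w` in `H¹(Ω)`. -/
def IsTrace {d : ℕ} (Ω Γ : Set (Pt d)) (w : Pt d → ℝ) (Dw : Pt d → Fin d → ℝ)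
    (τ : Pt d → ℝ) : Prop :=
  MemLp τ 2 ((surface d).restrict Γ) ∧
  ∃ φ : ℕ → Pt d → ℝ, (∀ n, ContDiff ℝ ∞ (φ n)) ∧
    Tendsto (fun n => eLpNorm (fun x => φ n x - w x) 2 (volume.restrict Ω)) atTop (𝓝 0) ∧
    (∀ j, Tendsto (fun n => eLpNorm (fun x => partialDeriv j (φ n) x - Dw x j) 2
      (volume.restrict Ω)) atTop (𝓝 0)) ∧
    Tendsto (fun n => eLpNorm (fun x => φ n x - τ x) 2 ((surface d).restrict Γ)) atTop (𝓝 0)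

/-! ### Normals and tensor algebra -/

/-- `ν` is the outward unit normal at `x` to a set `S` whose boundary is differentiable at `x`:
to first order at `x`, the set `S` lies in `⟪y - x, ν⟫ ≤ 0` and the complement of its closure
lies in `⟪y - x, ν⟫ ≥ 0`. There is at most one such `ν`. -/
def IsOutwardNormal {d : ℕ} (S : Set (Pt d)) (x ν : Pt d) : Prop :=
  ‖ν‖ = 1 ∧ ∀ ε : ℝ, 0 < ε → ∀ᶠ y in 𝓝 x,
    (y ∈ S → inner ℝ (y - x) ν ≤ ε * ‖y - x‖) ∧
    (y ∉ closure S → -(ε * ‖y - x‖) ≤ inner ℝ (y - x) ν)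

open Classical in
/-- The outward unit normal field of `S`, set to zero at the points that have no normal
(for a polyhedral set: off its boundary, and on the boundaries of its facets). -/
noncomputable def outwardNormal {d : ℕ} (S : Set (Pt d)) (x : Pt d) : Pt d :=
  if h : ∃ ν, IsOutwardNormal S x ν then h.choose else 0

/-- The symmetric part of a matrix; `strain (∇u)` is the strain rate tensor `ε(u)`. -/
noncomputable def strain {d : ℕ} (A : Matrix (Fin d) (Fin d) ℝ) : Matrix (Fin d) (Fin d) ℝ :=
  (1 / 2 : ℝ) • (A + A.transpose)

/-- The Frobenius product of matrices. -/
def ddot {d : ℕ} (A B : Matrix (Fin d) (Fin d) ℝ) : ℝ := ∑ i, ∑ j, A i j * B i j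

/-- A matrix applied to a vector of `ℝ^d`. -/
noncomputable def matVec {d : ℕ} (A : Matrix (Fin d) (Fin d) ℝ) (v : Pt d) : Pt d :=
  WithLp.toLp 2 (A.mulVec (fun j => v j))

/-- The tangential component `w^t = w - (w · n) n`. -/
noncomputable def tangential {d : ℕ} (n w : Pt d) : Pt d := w - (inner ℝ w n : ℝ) • n

/-- The gradient of a smooth vector field, `(∇v)_{ij} = ∂_j v_i`. -/
noncomputable def jacobian {d : ℕ} (v : Pt d → Pt d) (x : Pt d) : Matrix (Fin d) (Fin d) ℝ :=
  Matrix.of fun i j => partialDeriv j (fun y => v y i) x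

/-- The vector `∇ · ε(u)` in terms of the second derivatives `H i j k = ∂_k ∂_j u_i`. -/
noncomputable def divStrain {d : ℕ} (H : Fin d → Fin d → Fin d → ℝ) (i : Fin d) : ℝ :=
  ∑ j, (H i j j + H j i j) / 2

/-! ### The domain, its two parts and their triangulations -/

/-- The physical parameters `μ, κ_f, κ_m, σ, α` and the penalty parameter `β` of the method. -/
structure Params where
  mu : ℝ
  kf : ℝ
  km : ℝ
  sigma : ℝ
  alpha : ℝ
  beta : ℝ

/-- The domain `Ω`, the free flow domain `Ωs`, the porous medium domain `Ωd`, and triangulations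
of `Ωs` and `Ωd`. A simplex of a triangulation is given by its set of vertices. -/
structure MeshedDomain (d : ℕ) where
  Ω : Set (Pt d)
  Ωs : Set (Pt d)
  Ωd : Set (Pt d)
  Ts : Finset (Finset (Pt d))
  Td : Finset (Finset (Pt d))

/-- The closed simplex with the given set of vertices. -/
def cell {d : ℕ} (K : Finset (Pt d)) : Set (Pt d) := convexHull ℝ (K : Set (Pt d))

/-- The boundary of the closed simplex with the given vertices. -/
def bdry {d : ℕ} (K : Finset (Pt d)) : Set (Pt d) := frontier (cell K)

/-- The outward unit normal of a simplex. -/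
noncomputable def cellNormal {d : ℕ} (K : Finset (Pt d)) : Pt d → Pt d := outwardNormal (cell K)

/-- The vertex sets of the facets of the simplices of a triangulation. -/
def facets {d : ℕ} (T : Finset (Finset (Pt d))) : Set (Finset (Pt d)) :=
  {F | F.card = d ∧ ∃ K ∈ T, F ⊆ K}

/-- The mesh skeleton: the union of all facets of a triangulation. -/
def skeleton {d : ℕ} (T : Finset (Finset (Pt d))) : Set (Pt d) := ⋃ K ∈ T, bdry K

namespace MeshedDomain

variable {d : ℕ} (G : MeshedDomain d)

/-- The interface between the two subdomains. -/
def ΓI : Set (Pt d) := closure G.Ωs ∩ closure G.Ωd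

/-- The outer boundary of the free flow domain. -/
def Γs : Set (Pt d) := frontier G.Ωs ∩ frontier G.Ω

/-- The outer boundary of the porous medium domain. -/
def Γd : Set (Pt d) := frontier G.Ωd ∩ frontier G.Ω

/-- The simplices of the triangulation of the whole domain. -/
def IsCell (K : Finset (Pt d)) : Prop := K ∈ G.Ts ∨ K ∈ G.Td

/-- The standing assumptions on the domain and its triangulation. A set that is the interior of
its closure is open and does not have cracks; Lipschitz domains are of this kind. The two
triangulations match at the interface: together they form a conforming triangulation. -/
structure IsAdmissible : Prop where
  regular : interior (closure G.Ω) = G.Ω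
  regular_s : interior (closure G.Ωs) = G.Ωs
  regular_d : interior (closure G.Ωd) = G.Ωd
  disjoint : Disjoint G.Ωs G.Ωd
  closure_eq : closure G.Ω = closure G.Ωs ∪ closure G.Ωd
  cover_s : closure G.Ωs = ⋃ K ∈ G.Ts, cell K
  cover_d : closure G.Ωd = ⋃ K ∈ G.Td, cell K
  card_eq : ∀ K, G.IsCell K → K.card = d + 1
  indep : ∀ K, G.IsCell K → AffineIndependent ℝ ((↑) : K → Pt d)
  conforming : ∀ K L, G.IsCell K → G.IsCell L →
    cell K ∩ cell L = convexHull ℝ ((K : Set (Pt d)) ∩ (L : Set (Pt d)))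

end MeshedDomain

/-! ### The bilinear forms of the HDG method -/

/-- A velocity argument `(u, ū, u^m)` of the bilinear forms. The functions `u` and `u^m` are
elementwise functions: for each simplex `K` the argument consists of the function on `K`, its
gradient on `K`, and the traces on the boundary of `K`, taken from inside `K`. -/
structure VelocityArg (d : ℕ) where
  u : Finset (Pt d) → Pt d → Pt d
  gradU : Finset (Pt d) → Pt d → Matrix (Fin d) (Fin d) ℝ
  traceU : Finset (Pt d) → Pt d → Pt d
  traceGradU : Finset (Pt d) → Pt d → Matrix (Fin d) (Fin d) ℝ
  ubar : Pt d → Pt d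
  um : Finset (Pt d) → Pt d → Pt d
  gradUm : Finset (Pt d) → Pt d → Matrix (Fin d) (Fin d) ℝ
  traceUm : Finset (Pt d) → Pt d → Pt d

/-- A pressure argument `(p, p̄^s, p̄^d, p^m, p̄^m)` of the bilinear forms. -/
structure PressureArg (d : ℕ) where
  p : Pt d → ℝ
  pbarS : Pt d → ℝ
  pbarD : Pt d → ℝ
  pm : Pt d → ℝ
  pbarM : Pt d → ℝ

section Forms

variable {d : ℕ} (c : Params) (G : MeshedDomain d)

/-- The Stokes form `a_h^s`. -/
noncomputable def aFormS (u v : VelocityArg d) : ℝ :=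
  (∑ K ∈ G.Ts, ∫ x in cell K, 2 * c.mu * ddot (strain (u.gradU K x)) (strain (v.gradU K x)))
  - (∑ K ∈ G.Ts, ∫ x in bdry K,
      2 * c.mu * inner ℝ (matVec (strain (u.traceGradU K x)) (cellNormal K x))
        (v.traceU K x - v.ubar x) ∂(surface d))
  - (∑ K ∈ G.Ts, ∫ x in bdry K,
      2 * c.mu * inner ℝ (matVec (strain (v.traceGradU K x)) (cellNormal K x))
        (u.traceU K x - u.ubar x) ∂(surface d))
  + ∑ K ∈ G.Ts, 2 * c.beta * c.mu * (Metric.diam (cell K))⁻¹ *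
      ∫ x in bdry K, inner ℝ (u.traceU K x - u.ubar x) (v.traceU K x - v.ubar x) ∂(surface d)

/-- The form `a_h^d`. -/
noncomputable def aFormD (u v : VelocityArg d) : ℝ :=
  ∑ K ∈ G.Td, ∫ x in cell K, c.kf⁻¹ * inner ℝ (u.u K x) (v.u K x)

/-- The form `a_h^m`. -/
noncomputable def aFormM (u v : VelocityArg d) : ℝ :=
  ∑ K ∈ G.Td, ∫ x in cell K, c.km⁻¹ * inner ℝ (u.um K x) (v.um K x)

/-- The interface form `a_h^I`; the unit normal on the interface is that of `Ωs`. -/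
noncomputable def aFormI (u v : VelocityArg d) : ℝ :=
  ∫ x in G.ΓI, c.alpha * c.mu * c.kf ^ (-(1 / 2) : ℝ) *
    inner ℝ (tangential (outwardNormal G.Ωs x) (u.ubar x))
      (tangential (outwardNormal G.Ωs x) (v.ubar x)) ∂(surface d)

/-- The form `a_h`. -/
noncomputable def aForm (u v : VelocityArg d) : ℝ :=
  aFormS c G u v + aFormD c G u v + aFormM c G u v + aFormI c G u v

/-- The form `-(p, ∇·v) + ⟨p̄, v·n⟩` over a triangulation `T`, where `Dv` and `trv` are the
elementwise gradient and trace of `v`. -/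
noncomputable def bFormOn (T : Finset (Finset (Pt d))) (p pbar : Pt d → ℝ)
    (Dv : Finset (Pt d) → Pt d → Matrix (Fin d) (Fin d) ℝ)
    (trv : Finset (Pt d) → Pt d → Pt d) : ℝ :=
  - (∑ K ∈ T, ∫ x in cell K, p x * (Dv K x).trace)
  + ∑ K ∈ T, ∫ x in bdry K, pbar x * inner ℝ (trv K x) (cellNormal K x) ∂(surface d)

/-- The interface form `b_h^{I,j}` of the subdomain `Ωj`. -/
noncomputable def bFormI (Ωj : Set (Pt d)) (pbar : Pt d → ℝ) (vbar : Pt d → Pt d) : ℝ :=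
  - ∫ x in G.ΓI, pbar x * inner ℝ (vbar x) (outwardNormal Ωj x) ∂(surface d)

/-- The form `b_h`. -/
noncomputable def bForm (p : PressureArg d) (v : VelocityArg d) : ℝ :=
  (bFormOn G.Ts p.p p.pbarS v.gradU v.traceU + bFormI G G.Ωs p.pbarS v.ubar)
  + (bFormOn G.Td p.p p.pbarD v.gradU v.traceU + bFormI G G.Ωd p.pbarD v.ubar)
  + bFormOn G.Td p.pm p.pbarM v.gradUm v.traceUm

/-- The form `c_h`. -/
noncomputable def cForm (p q : PressureArg d) : ℝ :=
  c.sigma * c.km * ∑ K ∈ G.Td, ∫ x in cell K, (p.pm x - p.p x) * (q.pm x - q.p x)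

end Forms

/-! ### The discrete spaces -/

/-- A polynomial function on `ℝ^d` of total degree at most `k`. -/
def IsPoly {d : ℕ} (k : ℕ) (w : Pt d → ℝ) : Prop :=
  ∃ P : MvPolynomial (Fin d) ℝ, P.totalDegree ≤ k ∧
    ∀ x : Pt d, w x = MvPolynomial.eval (fun i => x i) P

/-- A polynomial vector field on `ℝ^d` of total degree at most `k`. -/
def IsPolyVec {d : ℕ} (k : ℕ) (w : Pt d → Pt d) : Prop := ∀ i, IsPoly k (fun x => w x i)

/-- An elementwise polynomial velocity `v_h` (the polynomial on `K` is `v K`) with a function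
`v̄_h` on the skeleton and an elementwise polynomial `v_h^m`, as an argument of the forms:
gradients are classical, and the trace from inside `K` is the value of the polynomial on `K`. -/
noncomputable def discreteVelocity {d : ℕ} (v : Finset (Pt d) → Pt d → Pt d) (vbar : Pt d → Pt d)
    (vm : Finset (Pt d) → Pt d → Pt d) : VelocityArg d where
  u := v
  gradU := fun K => jacobian (v K)
  traceU := v
  traceGradU := fun K => jacobian (v K)
  ubar := vbar
  um := vm
  gradUm := fun K => jacobian (vm K)
  traceUm := vm

section Spaces

variable {d : ℕ} (G : MeshedDomain d) (k : ℕ)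

/-- `v ∈ V_h`. -/
def InVh (v : Finset (Pt d) → Pt d → Pt d) : Prop := ∀ K, G.IsCell K → IsPolyVec k (v K)

/-- `v ∈ V_h^d`. -/
def InVhd (v : Finset (Pt d) → Pt d → Pt d) : Prop := ∀ K ∈ G.Td, IsPolyVec k (v K)

/-- `v̄ ∈ V̄_h`. -/
def InVbar (vbar : Pt d → Pt d) : Prop :=
  (∀ F ∈ facets G.Ts, ∃ w, IsPolyVec k w ∧ ∀ᵐ x ∂((surface d).restrict (cell F)), vbar x = w x) ∧
  ∀ᵐ x ∂((surface d).restrict G.Γs), vbar x = 0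

/-- `q̄` belongs to the space `Q̄_h^j` over the triangulation `T = T^j`. -/
def InQbar (T : Finset (Finset (Pt d))) (qbar : Pt d → ℝ) : Prop :=
  ∀ F ∈ facets T, ∃ w, IsPoly k w ∧ ∀ᵐ x ∂((surface d).restrict (cell F)), qbar x = w x

/-- `q ∈ Q_h`. -/
def InQh (q : Pt d → ℝ) : Prop :=
  (∀ K, G.IsCell K → ∃ w, IsPoly (k - 1) w ∧ ∀ᵐ x ∂(volume.restrict (cell K)), q x = w x) ∧
  ∫ x in G.Ω, q x = 0

/-- `q ∈ Q_h^m`. -/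
def InQhm (q : Pt d → ℝ) : Prop :=
  (∀ K ∈ G.Td, ∃ w, IsPoly (k - 1) w ∧ ∀ᵐ x ∂(volume.restrict (cell K)), q x = w x) ∧
  ∫ x in G.Ωd, q x = 0

/-- `q ∈ P_h`. -/
structure InPh (q : PressureArg d) : Prop where
  p : InQh G k q.p
  pbarS : InQbar k G.Ts q.pbarS
  pbarD : InQbar k G.Td q.pbarD
  pm : InQhm G k q.pm
  pbarM : InQbar k G.Td q.pbarM

/-- The arguments `u = (u, ū, u^m)` and `p = (p, p̄^s, p̄^d, p^m, p̄^m)` satisfy the equations of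
the HDG method for all discrete test functions. -/
def SatisfiesHDG (c : Params) (f : Pt d → Pt d) (g : Pt d → ℝ)
    (u : VelocityArg d) (p : PressureArg d) : Prop :=
  (∀ (v : Finset (Pt d) → Pt d → Pt d) (vbar : Pt d → Pt d) (vm : Finset (Pt d) → Pt d → Pt d),
    InVh G k v → InVbar G k vbar → InVhd G k vm →
    aForm c G u (discreteVelocity v vbar vm) + bForm G p (discreteVelocity v vbar vm)
      = ∑ K ∈ G.Ts, ∫ x in cell K, inner ℝ (f x) (v K x)) ∧
  (∀ q : PressureArg d, InPh G k q →
    bForm G q u - cForm c G p q = - ∑ K ∈ G.Td, ∫ x in cell K, g x * q.p x)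

end Spaces

/-! ### The dual-porosity-Stokes problem -/

/-- The unknowns `u, u^m, p, p^m` with their derivatives and traces: `Du x i j` is `∂_j u_i`,
`D2u x i j k` is `∂_k ∂_j u_i`, `Dp x j` is `∂_j p`, and so on. Since `u` and `p` live on both
subdomains, their derivatives are taken in each subdomain separately. The fields `usT`, `udT`,
`psT`, `pdT` are the traces of `u^s`, `u^d`, `p^s`, `p^d`, the field `DusT` is the trace of
the gradient of `u^s`, and `umT`, `pmT` are the traces of `u^m`, `p^m`. -/
structure Fields (d : ℕ) where
  u : Pt d → Pt d
  Du : Pt d → Matrix (Fin d) (Fin d) ℝ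
  D2u : Pt d → Fin d → Fin d → Fin d → ℝ
  um : Pt d → Pt d
  Dum : Pt d → Matrix (Fin d) (Fin d) ℝ
  p : Pt d → ℝ
  Dp : Pt d → Fin d → ℝ
  pm : Pt d → ℝ
  Dpm : Pt d → Fin d → ℝ
  usT : Pt d → Pt d
  DusT : Pt d → Matrix (Fin d) (Fin d) ℝ
  udT : Pt d → Pt d
  umT : Pt d → Pt d
  psT : Pt d → ℝ
  pdT : Pt d → ℝ
  pmT : Pt d → ℝ

namespace Fields

variable {d : ℕ} (S : Fields d) (c : Params) (G : MeshedDomain d)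

/-- The smoothness of the solution: `u^s ∈ H²(Ωs)^d`, `u^d, u^m ∈ H¹(Ωd)^d`, `p^s ∈ H¹(Ωs)` and
`p^d, p^m ∈ H¹(Ωd)`. -/
structure IsSmooth : Prop where
  us : ∀ i, IsH1 G.Ωs (fun x => S.u x i) (fun x => S.Du x i)
  Dus : ∀ i j, IsH1 G.Ωs (fun x => S.Du x i j) (fun x => S.D2u x i j)
  ud : ∀ i, IsH1 G.Ωd (fun x => S.u x i) (fun x => S.Du x i)
  um : ∀ i, IsH1 G.Ωd (fun x => S.um x i) (fun x => S.Dum x i)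
  ps : IsH1 G.Ωs S.p S.Dp
  pd : IsH1 G.Ωd S.p S.Dp
  pm : IsH1 G.Ωd S.pm S.Dpm

/-- The trace fields are the traces on the mesh skeletons (which contain the boundaries of the
subdomains) of the respective functions. -/
structure HasTraces : Prop where
  us : ∀ i, IsTrace G.Ωs (skeleton G.Ts) (fun x => S.u x i) (fun x => S.Du x i)
    (fun x => S.usT x i)
  Dus : ∀ i j, IsTrace G.Ωs (skeleton G.Ts) (fun x => S.Du x i j) (fun x => S.D2u x i j)
    (fun x => S.DusT x i j)
  ud : ∀ i, IsTrace G.Ωd (skeleton G.Td) (fun x => S.u x i) (fun x => S.Du x i)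
    (fun x => S.udT x i)
  um : ∀ i, IsTrace G.Ωd (skeleton G.Td) (fun x => S.um x i) (fun x => S.Dum x i)
    (fun x => S.umT x i)
  ps : IsTrace G.Ωs (skeleton G.Ts) S.p S.Dp S.psT
  pd : IsTrace G.Ωd (skeleton G.Td) S.p S.Dp S.pdT
  pm : IsTrace G.Ωd (skeleton G.Td) S.pm S.Dpm S.pmT

/-- The Stokes equations in `Ωs` with their boundary condition. -/
structure SolvesStokes (f : Pt d → Pt d) : Prop where
  momentum : ∀ᵐ x ∂(volume.restrict G.Ωs), ∀ i,
    -(2 * c.mu * divStrain (S.D2u x) i) + S.Dp x i = f x i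
  mass : ∀ᵐ x ∂(volume.restrict G.Ωs), (S.Du x).trace = 0
  boundary : ∀ᵐ x ∂((surface d).restrict G.Γs), S.usT x = 0

/-- The dual-porosity model in `Ωd` with its boundary conditions. -/
structure SolvesDualPorosity (g : Pt d → ℝ) : Prop where
  darcy_f : ∀ᵐ x ∂(volume.restrict G.Ωd), ∀ i, c.kf⁻¹ * S.u x i + S.Dp x i = 0
  mass_f : ∀ᵐ x ∂(volume.restrict G.Ωd),
    (S.Du x).trace + c.sigma * c.km * (S.p x - S.pm x) = g x
  darcy_m : ∀ᵐ x ∂(volume.restrict G.Ωd), ∀ i, c.km⁻¹ * S.um x i + S.Dpm x i = 0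
  mass_m : ∀ᵐ x ∂(volume.restrict G.Ωd),
    (S.Dum x).trace + c.sigma * c.km * (S.pm x - S.p x) = 0
  boundary_m : ∀ᵐ x ∂((surface d).restrict G.Γd),
    inner ℝ (S.umT x) (outwardNormal G.Ωd x) = 0
  boundary_f : ∀ᵐ x ∂((surface d).restrict G.Γd),
    inner ℝ (S.udT x) (outwardNormal G.Ωd x) = 0

/-- The interface conditions; the unit normal `n` on the interface is that of `Ωs`. -/
structure SolvesInterface : Prop where
  no_exchange : ∀ᵐ x ∂((surface d).restrict G.ΓI),
    inner ℝ (S.umT x) (outwardNormal G.Ωs x) = 0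
  mass : ∀ᵐ x ∂((surface d).restrict G.ΓI),
    inner ℝ (S.usT x) (outwardNormal G.Ωs x) - inner ℝ (S.udT x) (outwardNormal G.Ωs x) = 0
  force : ∀ᵐ x ∂((surface d).restrict G.ΓI),
    -(2 * c.mu * inner ℝ (matVec (strain (S.DusT x)) (outwardNormal G.Ωs x))
      (outwardNormal G.Ωs x)) + S.psT x = S.pdT x
  slip : ∀ᵐ x ∂((surface d).restrict G.ΓI),
    -((2 * c.mu) • tangential (outwardNormal G.Ωs x)
        (matVec (strain (S.DusT x)) (outwardNormal G.Ωs x)))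
      = (c.alpha * c.mu * c.kf ^ (-(1 / 2) : ℝ)) • tangential (outwardNormal G.Ωs x) (S.usT x)

/-- `(u, u^m, p, p^m)` solves the dual-porosity-Stokes problem with sources `f` and `g`. -/
structure SolvesProblem (f : Pt d → Pt d) (g : Pt d → ℝ) : Prop where
  stokes : S.SolvesStokes c G f
  dualPorosity : S.SolvesDualPorosity c G g
  interface : S.SolvesInterface c G

open Classical in
/-- The triple `(u, ū, u^m)`, where `ū` is the trace of `u^s` on the skeleton, as an argument of
the bilinear forms. The forms use the trace of the gradient of `u` only in `Ωs`. -/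
noncomputable def velocity : VelocityArg d where
  u := fun _ => S.u
  gradU := fun _ => S.Du
  traceU := fun K => if K ∈ G.Ts then S.usT else S.udT
  traceGradU := fun _ => S.DusT
  ubar := S.usT
  um := fun _ => S.um
  gradUm := fun _ => S.Dum
  traceUm := fun _ => S.umT

/-- The tuple `(p, p̄^s, p̄^d, p^m, p̄^m)`, where `p̄^j` is the trace of `p^j` on the skeleton. -/
def pressure : PressureArg d where
  p := S.p
  pbarS := S.psT
  pbarD := S.pdT
  pm := S.pm
  pbarM := S.pmT

end Fields

end DualPorosityStokes

/-! For the exact solution `ū` is the trace of `u^s`, so every term of `a_h` with a factor `u - ū`,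
the penalty included, vanishes. Green's formula on each simplex turns the remaining volume terms
into the differential equations tested with discrete functions. What is left are facet integrals of
the form `∑_K ∫_{∂K} F · n`, with one field `F` for all simplices: `F = 2μ ε(u^s) v̄` in the
momentum equation (`ε` being symmetric), and `F = q̄ u` or `q̄ u^m` in the mass equation. On an
interior facet the two normals are opposite and the contributions cancel, so only the flux through
`∂Ω^j` survives. On `Γ^j` it is killed by the boundary conditions, or by `v̄ = 0`; on `Γ^I` the
interface conditions balance it against the interface terms of `a_h` and `b_h`.

Two facts carry this. The analytic one is `green`, Green's formula for a Sobolev function with a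
trace, obtained by density from the divergence theorem `integral_fderiv_cell`. The latter is proved
for polytopes: multiply by a smooth cutoff supported in the polytope, integrate by parts over the
whole space, and let the gradient of the cutoff, which lives in strips of width `1 / R` along the
faces, concentrate to the surface measure.

The geometric one is `IsMesh.sum_indicator_cellNormal`: at almost every point the cell normals add
up to the normal of the domain on its boundary, and to zero elsewhere. Off a null set of edges each
simplex is locally a half-space, and two half-spaces with null overlap have opposite normals. This
gives `IsMesh.sum_flux` and its version `IsMesh.sum_flux_eq_interface` for the interface. -/

namespace DualPorosityStokes

/-! ### Orthogonal coordinates adapted to a hyperplane -/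

theorem volume_inner_eq_null {E : Type*} [NormedAddCommGroup E] [InnerProductSpace ℝ E]
    [FiniteDimensional ℝ E] [MeasurableSpace E] [BorelSpace E] (L : E →ₗ[ℝ] ℝ) (hL : L ≠ 0)
    (c : ℝ) : volume {x : E | L x = c} = 0 := by
  obtain ⟨w, hw⟩ : ∃ w, L w ≠ 0 := by
    by_contra! h
    exact hL (LinearMap.ext h)
  let p : E := (c / L w) • w
  have hp : L p = c := by simp [p, hw]
  have hs : {x : E | L x = c} = (AffineSubspace.mk' p (LinearMap.ker L) : Set E) := by
    ext x
    simp [AffineSubspace.mem_mk', hp, sub_eq_zero]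
  rw [hs]
  refine Measure.addHaar_affineSubspace _ _ fun h => ?_
  have h1 := congrArg AffineSubspace.direction h
  rw [AffineSubspace.direction_mk', AffineSubspace.direction_top, LinearMap.ker_eq_top] at h1
  exact hL h1

/-- Orthogonal coordinates in which a given unit vector spans the first axis. -/
theorem exists_slab_coordinates {m : ℕ} (n : Pt (m + 1)) (hn : ‖n‖ = 1) :
    ∃ ψ : Pt m →ₗᵢ[ℝ] Pt (m + 1), (∀ z, inner ℝ (ψ z) n = 0) ∧
      (∀ x, inner ℝ x n = 0 → ∃ z, ψ z = x) ∧
      MeasurePreserving (fun p : ℝ × Pt m => p.1 • n + ψ p.2) volume volume := by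
  obtain ⟨b, hb⟩ := Orthonormal.exists_orthonormalBasis_extension_of_card_eq (𝕜 := ℝ)
    (E := Pt (m + 1)) (ι := Fin (m + 1)) (by simp) (v := fun _ => n) (s := {0}) (by
      rw [orthonormal_iff_ite]
      rintro ⟨i, hi⟩ ⟨j, hj⟩
      simp only [Set.mem_singleton_iff] at hi hj
      subst hi; subst hj
      simp [hn])
  have hb0 : b 0 = n := hb 0 rfl
  have hon := b.orthonormal
  let ψ₀ : Pt m →ₗ[ℝ] Pt (m + 1) :=
    { toFun := fun z => ∑ i, z i • b i.succ
      map_add' := by intro x y; simp [add_smul, Finset.sum_add_distrib]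
      map_smul' := by intro r x; simp [Finset.smul_sum, mul_smul] }
  have hψ (z : Pt m) : ψ₀ z = ∑ i, z i • b i.succ := rfl
  have hons : Orthonormal ℝ fun i : Fin m => b i.succ := hon.comp _ (Fin.succ_injective m)
  let ψ : Pt m →ₗᵢ[ℝ] Pt (m + 1) :=
    { ψ₀ with
      norm_map' := by
        intro z
        rw [← sq_eq_sq₀ (norm_nonneg _) (norm_nonneg _), ← real_inner_self_eq_norm_sq, hψ,
          hons.inner_sum, EuclideanSpace.real_norm_sq_eq]
        simp [sq] }
  refine ⟨ψ, fun z => ?_, fun x hx => ?_, ?_⟩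
  · change inner ℝ (ψ₀ z) n = 0
    rw [hψ, sum_inner]
    refine Finset.sum_eq_zero fun i _ => ?_
    rw [← hb0, inner_smul_left, hon.inner_eq_zero (Fin.succ_ne_zero i), mul_zero]
  · refine ⟨WithLp.toLp 2 fun i => inner ℝ (b i.succ) x, ?_⟩
    change ψ₀ _ = x
    rw [hψ]
    conv_rhs => rw [← b.sum_repr' x, Fin.sum_univ_succ]
    rw [hb0, real_inner_comm, hx]
    simp
  · have h1 := (volume_preserving_piFinSuccAbove (fun _ : Fin (m + 1) => ℝ) 0).symm
    have h2 : MeasurePreserving (Prod.map id (MeasurableEquiv.toLp 2 (Fin m → ℝ)).symm :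
        ℝ × Pt m → ℝ × (Fin m → ℝ)) volume volume :=
      (MeasurePreserving.id volume).prod (EuclideanSpace.volume_preserving_symm_measurableEquiv_toLp (Fin m))
    have h3 := (EuclideanSpace.volume_preserving_symm_measurableEquiv_toLp (Fin (m + 1))).symm
    have h4 := b.measurePreserving_repr_symm
    have h5 := (h4.comp h3).comp (h1.comp h2)
    have h6 : (fun p : ℝ × Pt m => p.1 • n + ψ p.2) = (b.repr.symm ∘
        (MeasurableEquiv.toLp 2 (Fin (m + 1) → ℝ)).symm.symm) ∘
        (MeasurableEquiv.piFinSuccAbove (fun _ => ℝ) 0).symm ∘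
          Prod.map id (MeasurableEquiv.toLp 2 (Fin m → ℝ)).symm := by
      funext p
      change p.1 • n + ψ₀ p.2 = _
      rw [hψ, ← hb0]
      simp [← b.sum_repr_symm, Fin.sum_univ_succ, MeasurableEquiv.piFinSuccAbove]
    rw [h6]
    exact h5

/-- The surface measure of a hyperplane in orthogonal coordinates. -/
theorem surface_restrict_hyperplane {m : ℕ} (n : Pt (m + 1)) (hn : ‖n‖ = 1)
    (ψ : Pt m →ₗᵢ[ℝ] Pt (m + 1)) (h0 : ∀ z, inner ℝ (ψ z) n = 0)
    (h1 : ∀ x, inner ℝ x n = 0 → ∃ z, ψ z = x) (c : ℝ) :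
    (surface (m + 1)).restrict {x | inner ℝ x n = c} =
      (volume : Measure (Pt m)).map (fun z => c • n + ψ z) := by
  have hγ : Isometry fun z => c • n + ψ z := (isometry_add_left _).comp ψ.isometry
  have hr : {x | inner ℝ x n = c} = Set.range fun z => c • n + ψ z := by
    ext x
    constructor
    · intro hx
      obtain ⟨z, hz⟩ := h1 (x - c • n) (by
        simp only [Set.mem_ofPred_eq] at hx
        simp [inner_sub_left, inner_smul_left, hn, hx])
      exact ⟨z, by simp [hz]⟩
    · rintro ⟨z, rfl⟩
      simp [inner_add_left, inner_smul_left, hn, h0]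
  rw [hr, ← EuclideanSpace.euclideanHausdorffMeasure_eq_volume, hγ.map_euclideanHausdorffMeasure]
  rfl

/-- Both coordinates are controlled by the point `x` they describe: the first through `⟪x, n⟫ = a +
b t`, the second because `ψ z` is `x` minus its normal part and `ψ` is an isometry. -/
theorem hasCompactSupport_comp_slab {m : ℕ} {n : Pt (m + 1)} (hn : ‖n‖ = 1)
    {ψ : Pt m →ₗᵢ[ℝ] Pt (m + 1)} (h0 : ∀ z, inner ℝ (ψ z) n = 0) (a : ℝ) {b : ℝ} (hb : b ≠ 0)
    {H : Pt (m + 1) → ℝ} (hs : HasCompactSupport H) :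
    HasCompactSupport fun p : ℝ × Pt m => H ((a + b * p.1) • n + ψ p.2) := by
  obtain ⟨r, hr⟩ := hs.isBounded.exists_norm_le
  refine HasCompactSupport.intro
    (isCompact_closedBall (0 : ℝ × Pt m) (max (|b|⁻¹ * (|a| + r)) (2 * r))) fun p hp => ?_
  by_contra h
  have hx := hr _ (subset_tsupport _ h)
  set x := (a + b * p.1) • n + ψ p.2 with hxdef
  have hin : inner ℝ x n = a + b * p.1 := by simp [x, inner_add_left, inner_smul_left, hn, h0]
  have h1 : |a + b * p.1| ≤ r := by
    rw [← hin]
    exact (abs_real_inner_le_norm x n).trans (by rw [hn, mul_one]; exact hx)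
  have h2 : ‖p.2‖ ≤ 2 * r := by
    rw [← ψ.norm_map, show ψ p.2 = x - (a + b * p.1) • n by simp [x]]
    refine (norm_sub_le _ _).trans ?_
    rw [norm_smul, hn, mul_one, Real.norm_eq_abs]
    linarith
  have h3 : |p.1| ≤ |b|⁻¹ * (|a| + r) := by
    rw [le_inv_mul_iff₀ (abs_pos.2 hb), ← abs_mul]
    calc |b * p.1| = |(a + b * p.1) - a| := by ring_nf
      _ ≤ |a + b * p.1| + |a| := abs_sub _ _
      _ ≤ |a| + r := by linarith
  refine hp (mem_closedBall_zero_iff.2 ?_)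
  rw [Prod.norm_def]
  exact max_le_max h3 h2

/-- Fubini and a substitution in the normal variable alone. With `b = -1 / R` it stretches a strip
of width `1 / R` to unit width, and the Jacobian supplies the factor `R`. -/
theorem integral_comp_slab {m : ℕ} {n : Pt (m + 1)} (hn : ‖n‖ = 1)
    {ψ : Pt m →ₗᵢ[ℝ] Pt (m + 1)} (h0 : ∀ z, inner ℝ (ψ z) n = 0)
    (hψ : MeasurePreserving (fun p : ℝ × Pt m => p.1 • n + ψ p.2) volume volume)
    (a : ℝ) {b : ℝ} (hb : b ≠ 0) {H : Pt (m + 1) → ℝ} (hc : Continuous H)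
    (hs : HasCompactSupport H) :
    ∫ p : ℝ × Pt m, H ((a + b * p.1) • n + ψ p.2) = |b⁻¹| * ∫ x, H x := by
  have hi (a b : ℝ) (hb : b ≠ 0) :
      Integrable (fun p : ℝ × Pt m => H ((a + b * p.1) • n + ψ p.2)) (volume.prod volume) :=
    Continuous.integrable_of_hasCompactSupport (by fun_prop)
      (hasCompactSupport_comp_slab hn h0 a hb hs)
  have h1 := hi 0 1 one_ne_zero
  simp only [zero_add, one_mul] at h1
  rw [← hψ.map_eq, integral_map hψ.measurable.aemeasurable hc.aestronglyMeasurable]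
  rw [Measure.volume_eq_prod, integral_prod_symm _ (hi a b hb), integral_prod_symm _ h1,
    ← integral_const_mul]
  congr 1
  ext z
  rw [Measure.integral_comp_mul_left (fun t => H ((a + t) • n + ψ z)) b,
    integral_add_left_eq_self (fun t => H (t • n + ψ z)) a, smul_eq_mul]

/-! ### The boundary layer profile -/

/-- The profile of the boundary layers. -/
noncomputable abbrev layer : ℝ → ℝ := deriv Real.smoothTransition

theorem hasDerivAt_smoothTransition (t : ℝ) : HasDerivAt Real.smoothTransition (layer t) t :=
  ((Real.smoothTransition.contDiff (n := 1)).differentiable one_ne_zero t).hasDerivAt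

theorem continuous_layer : Continuous layer :=
  (Real.smoothTransition.contDiff (n := 1)).continuous_deriv le_rfl

theorem layer_eq_zero {t : ℝ} (ht : t ∉ Set.Icc (0 : ℝ) 1) : layer t = 0 := by
  have : t < 0 ∨ 1 < t := by
    by_contra! h
    exact ht h
  rcases this with h | h
  · have : Real.smoothTransition =ᶠ[𝓝 t] fun _ => 0 := by
      filter_upwards [Iio_mem_nhds h] with s hs
      exact Real.smoothTransition.zero_of_nonpos (le_of_lt hs)
    rw [layer, this.deriv_eq, deriv_const]
  · have : Real.smoothTransition =ᶠ[𝓝 t] fun _ => 1 := by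
      filter_upwards [Ioi_mem_nhds h] with s hs
      exact Real.smoothTransition.one_of_one_le (le_of_lt hs)
    rw [layer, this.deriv_eq, deriv_const]

theorem hasCompactSupport_layer : HasCompactSupport layer :=
  HasCompactSupport.intro isCompact_Icc fun _ ht => layer_eq_zero ht

/-- The transition climbs from 0 to 1. Unit mass is what makes the rescaled layers `R * layer (R *
·)` approximate a Dirac mass. -/
theorem integral_layer : ∫ t, layer t = 1 := by
  have := integral_of_hasDerivAt_of_tendsto hasDerivAt_smoothTransition
    (continuous_layer.integrable_of_hasCompactSupport hasCompactSupport_layer)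
    (m := 0) (n := 1)
    (tendsto_const_nhds.congr' (by
      filter_upwards [Iic_mem_atBot 0] with s hs
      exact (Real.smoothTransition.zero_of_nonpos hs).symm))
    (tendsto_const_nhds.congr' (by
      filter_upwards [Ici_mem_atTop 1] with s hs
      exact (Real.smoothTransition.one_of_one_le hs).symm))
  simpa using this

theorem tendsto_smoothTransition_of_pos {u : ℕ → ℝ} (hu : Tendsto u atTop atTop) :
    Tendsto (fun N => Real.smoothTransition (u N)) atTop (𝓝 1) :=
  tendsto_const_nhds.congr' (by
    filter_upwards [hu.eventually_ge_atTop 1] with N hN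
    exact (Real.smoothTransition.one_of_one_le hN).symm)

theorem tendsto_smoothTransition_of_neg {u : ℕ → ℝ} (hu : Tendsto u atTop atBot) :
    Tendsto (fun N => Real.smoothTransition (u N)) atTop (𝓝 0) :=
  tendsto_const_nhds.congr' (by
    filter_upwards [hu.eventually_le_atBot 0] with N hN
    exact (Real.smoothTransition.zero_of_nonpos hN).symm)

/-! ### The divergence theorem on a polytope -/

/-- `P` is the bounded polytope `⟪x, n i⟫ ≤ c i` with unit normals `n i`, no two parallel. -/
structure IsPolytope {d : ℕ} {ι : Type*} (P : Set (Pt d)) (n : ι → Pt d) (c : ι → ℝ) : Prop where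
  mem_iff : ∀ x, x ∈ P ↔ ∀ i, inner ℝ x (n i) ≤ c i
  norm_eq : ∀ i, ‖n i‖ = 1
  bounded : Bornology.IsBounded P
  not_parallel : ∀ i j, i ≠ j → ∃ w, inner ℝ w (n i) = 0 ∧ inner ℝ w (n j) ≠ 0

section Polytope

variable {m : ℕ} {ι : Type*} {P : Set (Pt (m + 1))} {n : ι → Pt (m + 1)} {c : ι → ℝ}

theorem IsPolytope.isClosed {d : ℕ} {P : Set (Pt d)} {n : ι → Pt d} (h : IsPolytope P n c) :
    IsClosed P := by
  have : P = ⋂ i, {x | inner ℝ x (n i) ≤ c i} := by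
    ext x
    simp [h.mem_iff]
  rw [this]
  exact isClosed_iInter fun i => isClosed_le (by fun_prop) continuous_const

theorem volume_hyperplane {d : ℕ} {ν : Pt d} (hν : ‖ν‖ = 1) (a : ℝ) :
    volume {x : Pt d | inner ℝ x ν = a} = 0 := by
  have := volume_inner_eq_null (innerSL ℝ ν).toLinearMap (fun h => by
    have := LinearMap.congr_fun h ν
    simp [hν] at this) a
  simpa [real_inner_comm] using this

/-- A smooth approximation of the indicator function of a polytope. -/
noncomputable def cutoff {d : ℕ} (n : ι → Pt d) (c : ι → ℝ) (s : Finset ι) (R : ℝ) (x : Pt d) :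
    ℝ :=
  ∏ i ∈ s, Real.smoothTransition (R * (c i - inner ℝ x (n i)))

theorem cutoff_nonneg {d : ℕ} (n : ι → Pt d) (c : ι → ℝ) (s : Finset ι) (R : ℝ) (x : Pt d) :
    0 ≤ cutoff n c s R x := Finset.prod_nonneg fun _ _ => Real.smoothTransition.nonneg _

theorem cutoff_le_one {d : ℕ} (n : ι → Pt d) (c : ι → ℝ) (s : Finset ι) (R : ℝ) (x : Pt d) :
    cutoff n c s R x ≤ 1 :=
  Finset.prod_le_one (fun _ _ => Real.smoothTransition.nonneg _)
    fun _ _ => Real.smoothTransition.le_one _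

theorem abs_cutoff_le_one {d : ℕ} (n : ι → Pt d) (c : ι → ℝ) (s : Finset ι) (R : ℝ) (x : Pt d) :
    |cutoff n c s R x| ≤ 1 := by
  rw [abs_of_nonneg (cutoff_nonneg ..)]
  exact cutoff_le_one ..

theorem inner_lt_of_cutoff_ne_zero {d : ℕ} {n : ι → Pt d} {s : Finset ι} {R : ℝ} (hR : 0 < R)
    {x : Pt d} (hx : cutoff n c s R x ≠ 0) {i : ι} (hi : i ∈ s) : inner ℝ x (n i) < c i := by
  have := Finset.prod_ne_zero_iff.1 hx i hi
  rw [Ne, Real.smoothTransition.zero_iff_nonpos, not_le, mul_pos_iff_of_pos_left hR] at this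
  linarith

theorem continuous_cutoff {d : ℕ} (n : ι → Pt d) (c : ι → ℝ) (s : Finset ι) (R : ℝ) :
    Continuous (cutoff n c s R) :=
  continuous_finsetProd _ fun i _ => Real.smoothTransition.continuous.comp (by fun_prop)

/-- Product rule. Each summand is a boundary layer at one face, cut off by the remaining
constraints. -/
theorem hasFDerivAt_cutoff [Fintype ι] [DecidableEq ι] {d : ℕ} (n : ι → Pt d) (c : ι → ℝ) (R : ℝ) (x : Pt d) :
    HasFDerivAt (cutoff n c Finset.univ R)
      (∑ i, cutoff n c (Finset.univ.erase i) R x • -((R * layer (R * (c i - inner ℝ x (n i)))) •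
        innerSL ℝ (n i))) x := by
  have h1 (i : ι) : HasFDerivAt (fun y : Pt d => R * (c i - inner ℝ y (n i)))
      (-(R • innerSL ℝ (n i))) x := by
    have h2 : HasFDerivAt (fun y : Pt d => inner ℝ y (n i)) (innerSL ℝ (n i)) x := by
      have := (innerSL ℝ (n i)).hasFDerivAt (x := x)
      refine this.congr_of_eventuallyEq (Eventually.of_forall fun y => ?_)
      simp [real_inner_comm]
    have := (h2.const_sub (c i)).const_mul R
    simpa using this
  have := HasFDerivAt.finsetProd (u := Finset.univ)
    (fun i _ => (hasDerivAt_smoothTransition (R * (c i - inner ℝ x (n i)))).comp_hasFDerivAt x (h1 i))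
  refine this.congr_fderiv (Finset.sum_congr rfl fun i _ => ?_)
  ext v
  simp only [cutoff, Function.comp_apply, smul_apply, neg_apply, smul_eq_mul]
  ring

/-- A shift of size `t / R` changes the rescaled distance to a hyperplane only by the constant `t *
⟪v, n i⟫`, which is negligible against `R * (c i - ⟪x, n i⟫)` off the hyperplane. The shift is
needed because the layer variable is rescaled along with the cutoff. -/
theorem tendsto_cutoff {d : ℕ} (n : ι → Pt d) (c : ι → ℝ) (s : Finset ι) {x v : Pt d} (t : ℝ)
    (hx : ∀ i ∈ s, inner ℝ x (n i) ≠ c i) :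
    Tendsto (fun N : ℕ => cutoff n c s ((N : ℝ) + 1) (x - (t / ((N : ℝ) + 1)) • v)) atTop
      (𝓝 (∏ i ∈ s, if inner ℝ x (n i) < c i then 1 else 0)) := by
  refine tendsto_finsetProd _ fun i hi => ?_
  have hN : Tendsto (fun N : ℕ => (N : ℝ) + 1) atTop atTop :=
    tendsto_atTop_add_const_right _ _ tendsto_natCast_atTop_atTop
  have he (N : ℕ) : ((N : ℝ) + 1) * (c i - inner ℝ (x - (t / ((N : ℝ) + 1)) • v) (n i)) =
      ((N : ℝ) + 1) * (c i - inner ℝ x (n i)) + t * inner ℝ v (n i) := by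
    have : (N : ℝ) + 1 ≠ 0 := by positivity
    rw [inner_sub_left, inner_smul_left]
    simp
    field_simp
    ring
  simp only [he]
  split_ifs with h
  · exact tendsto_smoothTransition_of_pos
      (tendsto_atTop_add_const_right _ _ (hN.atTop_mul_const (sub_pos.2 h)))
  · exact tendsto_smoothTransition_of_neg
      (tendsto_atBot_add_const_right _ _ (hN.atTop_mul_const_of_neg
        (sub_neg.2 (lt_of_le_of_ne (not_lt.1 h) (hx i hi).symm))))

theorem tendsto_cutoff_zero {d : ℕ} (n : ι → Pt d) (c : ι → ℝ) (s : Finset ι) {x : Pt d}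
    (hx : ∀ i ∈ s, inner ℝ x (n i) ≠ c i) :
    Tendsto (fun N : ℕ => cutoff n c s ((N : ℝ) + 1) x) atTop
      (𝓝 (∏ i ∈ s, if inner ℝ x (n i) < c i then 1 else 0)) := by
  simpa using tendsto_cutoff n c s (v := 0) 0 hx

/-- The cutoff approximates the indicator from inside: it vanishes outside `P`, so `|f|` on the
compact set `P` dominates. Convergence may fail only on the bounding hyperplanes, which are null. -/
theorem IsPolytope.tendsto_integral_cutoff [Fintype ι] {d : ℕ} {P : Set (Pt d)} {n : ι → Pt d}
    (h : IsPolytope P n c) {f : Pt d → ℝ} (hf : Continuous f) :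
    Tendsto (fun N : ℕ => ∫ x, cutoff n c Finset.univ ((N : ℝ) + 1) x * f x) atTop
      (𝓝 (∫ x in P, f x)) := by
  have hcomp : IsCompact P := Metric.isCompact_of_isClosed_isBounded h.isClosed h.bounded
  rw [← integral_indicator h.isClosed.measurableSet]
  refine tendsto_integral_of_dominated_convergence (fun x => P.indicator (fun x => |f x|) x)
    (fun N => ((continuous_cutoff ..).mul hf).aestronglyMeasurable) ?_ ?_ ?_
  · rw [integrable_indicator_iff h.isClosed.measurableSet]
    exact hf.abs.continuousOn.integrableOn_compact hcomp
  · refine fun N => Eventually.of_forall fun x => ?_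
    by_cases hx : x ∈ P
    · rw [Set.indicator_of_mem hx, Real.norm_eq_abs, abs_mul]
      exact mul_le_of_le_one_left (abs_nonneg _) (abs_cutoff_le_one ..)
    · rw [Set.indicator_of_notMem hx]
      have : cutoff n c Finset.univ ((N : ℝ) + 1) x = 0 := by
        by_contra h0
        exact hx ((h.mem_iff x).2 fun i =>
          (inner_lt_of_cutoff_ne_zero (by positivity) h0 (Finset.mem_univ i)).le)
      simp [this]
  · have : ∀ᵐ x : Pt d, ∀ i, inner ℝ x (n i) ≠ c i := by
      rw [ae_all_iff]
      intro i
      exact measure_eq_zero_iff_ae_notMem.1 (volume_hyperplane (h.norm_eq i) (c i))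
    filter_upwards [this] with x hx
    have h1 := (tendsto_cutoff_zero n c Finset.univ (fun i _ => hx i)).mul_const (f x)
    convert h1 using 2
    by_cases hxP : x ∈ P
    · rw [Set.indicator_of_mem hxP, Finset.prod_eq_one, one_mul]
      intro i _
      rw [if_pos (lt_of_le_of_ne ((h.mem_iff x).1 hxP i) (hx i))]
    · rw [Set.indicator_of_notMem hxP]
      rw [h.mem_iff] at hxP
      push Not at hxP
      obtain ⟨i, hi⟩ := hxP
      rw [Finset.prod_eq_zero (Finset.mem_univ i) (if_neg (not_lt.2 hi.le)), zero_mul]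

/-- The layer forces constraint `i`, being supported on the inner side of its hyperplane, and the
cutoff forces all the others. -/
theorem IsPolytope.layer_mul_cutoff_eq_zero [Fintype ι] [DecidableEq ι] {d : ℕ} {P : Set (Pt d)}
    {n : ι → Pt d} (h : IsPolytope P n c) (i : ι) {R : ℝ} (hR : 0 < R) {x : Pt d} (hx : x ∉ P)
    (a : ℝ) : layer (R * (c i - inner ℝ x (n i))) *
      (cutoff n c (Finset.univ.erase i) R x * a) = 0 := by
  by_contra h0
  refine hx ((h.mem_iff x).2 fun j => ?_)
  rcases eq_or_ne j i with rfl | hj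
  · by_contra h1
    refine h0 (mul_eq_zero_of_left (layer_eq_zero fun h2 => h1 ?_) _)
    have := (mul_nonneg_iff_of_pos_left hR).1 h2.1
    linarith
  · exact (inner_lt_of_cutoff_ne_zero hR (left_ne_zero_of_mul (right_ne_zero_of_mul h0))
      (Finset.mem_erase.2 ⟨hj, Finset.mem_univ j⟩)).le

/-- As the normals are not parallel, `⟪·, n j⟫` is not constant along hyperplane `i`, so the edge is
a proper affine subspace of it. -/
theorem IsPolytope.volume_edge (h : IsPolytope P n c) {i j : ι} (hij : i ≠ j)
    {ψ : Pt m →ₗᵢ[ℝ] Pt (m + 1)} (h1 : ∀ x, inner ℝ x (n i) = 0 → ∃ z, ψ z = x) :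
    volume {z : Pt m | inner ℝ (c i • n i + ψ z) (n j) = c j} = 0 := by
  have := volume_inner_eq_null ((innerSL ℝ (n j)).toLinearMap ∘ₗ ψ.toLinearMap) (fun hL => by
    obtain ⟨w, hw, hw'⟩ := h.not_parallel i j hij
    obtain ⟨z, rfl⟩ := h1 w hw
    have := LinearMap.congr_fun hL z
    rw [real_inner_comm] at hw'
    exact hw' this) (c j - inner ℝ (c i • n i) (n j))
  convert this using 2
  ext z
  simp [inner_add_left, eq_sub_iff_add_eq', real_inner_comm]

/-- In the coordinates `x = (c i - t / R) n i + ψ z` the prefactor `R` cancels the Jacobian and the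
layer becomes `layer t`, of mass one. The other factors tend to the values of `f` on the face,
extended by zero. -/
theorem IsPolytope.integral_layer_face [Fintype ι] [DecidableEq ι] (h : IsPolytope P n c) (i : ι)
    {f : Pt (m + 1) → ℝ} (hf : Continuous f) :
    Tendsto (fun N : ℕ => ((N : ℝ) + 1) * ∫ x, layer (((N : ℝ) + 1) * (c i - inner ℝ x (n i))) *
        (cutoff n c (Finset.univ.erase i) ((N : ℝ) + 1) x * f x)) atTop
      (𝓝 (∫ x in P ∩ {x | inner ℝ x (n i) = c i}, f x ∂(surface (m + 1)))) := by
  have hn := h.norm_eq i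
  obtain ⟨ψ, h0, h1, hψ⟩ := exists_slab_coordinates (n i) hn
  have hcomp : IsCompact P := Metric.isCompact_of_isClosed_isBounded h.isClosed h.bounded
  obtain ⟨r, hr⟩ := h.bounded.exists_norm_le
  obtain ⟨M, hM⟩ := hcomp.exists_bound_of_continuousOn hf.continuousOn
  obtain ⟨C, hC⟩ := continuous_layer.bounded_above_of_compact_support hasCompactSupport_layer
  have hγ : Continuous fun z => c i • n i + ψ z := by fun_prop
  have hlim : ∫ x in P ∩ {x | inner ℝ x (n i) = c i}, f x ∂(surface (m + 1)) =
      ∫ p : ℝ × Pt m, layer p.1 * P.indicator f (c i • n i + ψ p.2) := by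
    rw [Measure.volume_eq_prod, integral_prod_mul layer
      (fun z => P.indicator f (c i • n i + ψ z)), integral_layer, one_mul,
      ← Measure.restrict_restrict h.isClosed.measurableSet,
      ← integral_indicator h.isClosed.measurableSet,
      surface_restrict_hyperplane (n i) hn ψ h0 h1, integral_map hγ.aemeasurable
        (hf.stronglyMeasurable.indicator h.isClosed.measurableSet).aestronglyMeasurable]
  rw [hlim]
  let x (N : ℕ) (p : ℝ × Pt m) : Pt (m + 1) :=
    (c i • n i + ψ p.2) - (p.1 / ((N : ℝ) + 1)) • n i
  have hxi (N : ℕ) (p : ℝ × Pt m) :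
      ((N : ℝ) + 1) * (c i - inner ℝ (x N p) (n i)) = p.1 := by
    have : (N : ℝ) + 1 ≠ 0 := by positivity
    simp only [x, inner_add_left, inner_sub_left, inner_smul_left, h0,
      real_inner_self_eq_norm_sq, hn]
    simp
    field_simp
  have hsub (N : ℕ) : ((N : ℝ) + 1) * ∫ x, layer (((N : ℝ) + 1) * (c i - inner ℝ x (n i))) *
        (cutoff n c (Finset.univ.erase i) ((N : ℝ) + 1) x * f x) =
      ∫ p : ℝ × Pt m, layer p.1 *
        (cutoff n c (Finset.univ.erase i) ((N : ℝ) + 1) (x N p) * f (x N p)) := by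
    have hN : 0 < (N : ℝ) + 1 := by positivity
    -- The negative scale makes `t` the rescaled depth below face `i`.
    have := integral_comp_slab hn h0 hψ (c i) (b := -((N : ℝ) + 1)⁻¹)
      (neg_ne_zero.2 (inv_ne_zero hN.ne'))
      (H := fun x => layer (((N : ℝ) + 1) * (c i - inner ℝ x (n i))) *
        (cutoff n c (Finset.univ.erase i) ((N : ℝ) + 1) x * f x))
      ((continuous_layer.comp (by fun_prop)).mul ((continuous_cutoff ..).mul hf))
      (HasCompactSupport.intro hcomp fun x hx => h.layer_mul_cutoff_eq_zero i hN hx _)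
    rw [inv_neg, inv_inv, abs_neg, abs_of_pos hN] at this
    rw [← this]
    congr 1
    ext p
    have hp : (c i + -((N : ℝ) + 1)⁻¹ * p.1) • n i + ψ p.2 = x N p := by
      simp only [x, add_smul, neg_mul, neg_smul, div_eq_inv_mul]
      abel
    rw [hp, hxi]
  simp only [hsub]
  -- A support common to all integrands: `t` lies in the support of the layer, and `ψ z` is the
  -- tangential part of a point of `P`, whence the radius `2 * r`. The `max` below keeps the bound
  -- nonnegative should `P` be empty.
  let B : Set (ℝ × Pt m) := Set.Icc 0 1 ×ˢ Metric.closedBall 0 (2 * r)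
  have hB : IsCompact B := isCompact_Icc.prod (isCompact_closedBall _ _)
  refine tendsto_integral_of_dominated_convergence (B.indicator fun _ => C * max M 0)
    (fun N => (Continuous.mul (continuous_layer.comp continuous_fst) (Continuous.mul
      ((continuous_cutoff ..).comp (by fun_prop)) (hf.comp (by fun_prop)))).aestronglyMeasurable)
    ?_ ?_ ?_
  · rw [integrable_indicator_iff hB.measurableSet]
    exact continuousOn_const.integrableOn_compact hB
  · refine fun N => Eventually.of_forall fun p => ?_
    have hN : 0 < (N : ℝ) + 1 := by positivity
    by_cases hz : layer p.1 * (cutoff n c (Finset.univ.erase i) ((N : ℝ) + 1) (x N p) *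
        f (x N p)) = 0
    · rw [hz, norm_zero]
      by_cases hp : p ∈ B
      · rw [Set.indicator_of_mem hp]
        exact mul_nonneg ((norm_nonneg _).trans (hC 0)) (le_max_right _ _)
      · rw [Set.indicator_of_notMem hp]
    · have hxP : x N p ∈ P := by
        by_contra hx
        have := h.layer_mul_cutoff_eq_zero i hN hx (f (x N p))
        rw [hxi] at this
        exact hz this
      have hp1 : p.1 ∈ Set.Icc (0 : ℝ) 1 := by
        by_contra hp1
        exact hz (by rw [layer_eq_zero hp1, zero_mul])
      have hp2 : p.2 ∈ Metric.closedBall 0 (2 * r) := by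
        rw [mem_closedBall_zero_iff, ← ψ.norm_map]
        have he : ψ p.2 = x N p - inner ℝ (x N p) (n i) • n i := by
          have h3 : inner ℝ (x N p) (n i) = c i - p.1 / ((N : ℝ) + 1) := by
            simp [x, inner_add_left, inner_sub_left, inner_smul_left, h0, hn]
          rw [h3]
          simp only [x, sub_smul]
          abel
        have h4 := abs_real_inner_le_norm (x N p) (n i)
        rw [hn, mul_one] at h4
        rw [he]
        refine (norm_sub_le _ _).trans ?_
        rw [norm_smul, hn, mul_one, Real.norm_eq_abs]
        linarith [hr _ hxP]
      rw [Set.indicator_of_mem (Set.mk_mem_prod hp1 hp2), norm_mul, norm_mul]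
      refine mul_le_mul (hC _) ?_ (by positivity) ((norm_nonneg _).trans (hC 0))
      exact (mul_le_of_le_one_left (norm_nonneg _) (abs_cutoff_le_one ..)).trans
        ((hM _ hxP).trans (le_max_left _ _))
  · have hae : ∀ᵐ p : ℝ × Pt m, ∀ j, j ≠ i → inner ℝ (c i • n i + ψ p.2) (n j) ≠ c j := by
      rw [ae_all_iff]
      intro j
      by_cases hj : j = i
      · exact Eventually.of_forall fun p h => absurd hj h
      have hz : ∀ᵐ z : Pt m, inner ℝ (c i • n i + ψ z) (n j) ≠ c j :=
        measure_eq_zero_iff_ae_notMem.1 (h.volume_edge (Ne.symm hj) h1)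
      have := (Measure.quasiMeasurePreserving_snd (μ := (volume : Measure ℝ))
        (ν := (volume : Measure (Pt m)))).ae hz
      filter_upwards [this] with p hp _ using hp
    filter_upwards [hae] with p hp
    have hx : Tendsto (fun N => x N p) atTop (𝓝 (c i • n i + ψ p.2)) := by
      have h5 : Tendsto (fun N : ℕ => p.1 / ((N : ℝ) + 1)) atTop (𝓝 0) :=
        (tendsto_atTop_add_const_right _ _ tendsto_natCast_atTop_atTop).const_div_atTop _
      simpa using tendsto_const_nhds.sub (h5.smul_const (n i))
    have h6 := tendsto_cutoff n c (Finset.univ.erase i) (v := n i) p.1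
      (fun j hj => hp j (Finset.ne_of_mem_erase hj))
    have h7 := (h6.mul ((hf.tendsto _).comp hx)).const_mul (layer p.1)
    suffices h8 : P.indicator f (c i • n i + ψ p.2) = (∏ j ∈ Finset.univ.erase i,
        if inner ℝ (c i • n i + ψ p.2) (n j) < c j then 1 else 0) * f (c i • n i + ψ p.2) by
      rw [h8]
      exact h7
    by_cases hxP : c i • n i + ψ p.2 ∈ P
    · rw [Set.indicator_of_mem hxP, Finset.prod_eq_one, one_mul]
      intro j hj
      rw [if_pos (lt_of_le_of_ne ((h.mem_iff _).1 hxP j) (hp j (Finset.ne_of_mem_erase hj)))]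
    · rw [Set.indicator_of_notMem hxP]
      rw [h.mem_iff] at hxP
      push Not at hxP
      obtain ⟨j, hj⟩ := hxP
      have hji : j ≠ i := by
        rintro rfl
        simp [inner_add_left, inner_smul_left, hn, h0] at hj
      rw [Finset.prod_eq_zero (Finset.mem_erase.2 ⟨hji, Finset.mem_univ j⟩)
        (if_neg (not_lt.2 hj.le)), zero_mul]

/-- Integration by parts of `cutoff * φ` over the whole space has no boundary term. As `R → ∞`, one
side tends to the integral over `P`, and the gradient of the cutoff to the face integrals. -/
theorem IsPolytope.integral_fderiv [Fintype ι] (h : IsPolytope P n c) {φ : Pt (m + 1) → ℝ}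
    (hφ : ContDiff ℝ 1 φ) (e : Pt (m + 1)) :
    ∫ x in P, fderiv ℝ φ x e =
      ∑ i, inner ℝ (n i) e * ∫ x in P ∩ {x | inner ℝ x (n i) = c i}, φ x ∂(surface (m + 1)) := by
  classical
  have hcomp : IsCompact P := Metric.isCompact_of_isClosed_isBounded h.isClosed h.bounded
  have hl := h.tendsto_integral_cutoff
    ((hφ.continuous_fderiv one_ne_zero).clm_apply (continuous_const (y := e)))
  have hr := tendsto_finsetSum Finset.univ fun i _ =>
    (h.integral_layer_face i hφ.continuous).const_mul (inner ℝ (n i) e)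
  refine tendsto_nhds_unique hl (hr.congr fun N => ?_)
  have hR : 0 < (N : ℝ) + 1 := by positivity
  generalize (N : ℝ) + 1 = R at hR
  have hsupp : ∀ x, x ∉ P → cutoff n c Finset.univ R x = 0 := fun x hx => by
    by_contra h0
    exact hx ((h.mem_iff x).2 fun i =>
      (inner_lt_of_cutoff_ne_zero hR h0 (Finset.mem_univ i)).le)
  have hint (i : ι) : Integrable fun x => layer (R * (c i - inner ℝ x (n i))) *
        (cutoff n c (Finset.univ.erase i) R x * φ x) :=
    Continuous.integrable_of_hasCompactSupport
      ((continuous_layer.comp (by fun_prop)).mul ((continuous_cutoff ..).mul hφ.continuous))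
      (HasCompactSupport.intro hcomp fun x hx => h.layer_mul_cutoff_eq_zero i hR hx _)
  have hd (x : Pt (m + 1)) : fderiv ℝ (cutoff n c Finset.univ R) x e * φ x =
      -∑ i, inner ℝ (n i) e * (R * (layer (R * (c i - inner ℝ x (n i))) *
        (cutoff n c (Finset.univ.erase i) R x * φ x))) := by
    rw [(hasFDerivAt_cutoff n c R x).fderiv]
    simp only [sum_apply, smul_apply, neg_apply, innerSL_apply_apply, smul_eq_mul, Finset.sum_mul,
      ← Finset.sum_neg_distrib]
    exact Finset.sum_congr rfl fun i _ => by ring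
  have hIBP := integral_mul_fderiv_eq_neg_fderiv_mul_of_integrable (μ := volume)
    (f := cutoff n c Finset.univ R) (g := φ) (v := e) ?_ ?_ ?_
    (fun x _ => (hasFDerivAt_cutoff n c R x).differentiableAt)
    (fun x _ => hφ.differentiable one_ne_zero x)
  · rw [hIBP]
    simp only [hd, integral_neg, neg_neg]
    rw [integral_finsetSum _ fun i _ => ((hint i).const_mul R).const_mul _]
    simp only [integral_const_mul]
  · simp only [hd]
    exact (integrable_finsetSum _ fun i _ => ((hint i).const_mul R).const_mul _).neg
  · exact Continuous.integrable_of_hasCompactSupport ((continuous_cutoff ..).mul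
      ((hφ.continuous_fderiv one_ne_zero).clm_apply continuous_const))
      (HasCompactSupport.intro hcomp fun x hx => by simp [hsupp x hx])
  · exact Continuous.integrable_of_hasCompactSupport ((continuous_cutoff ..).mul hφ.continuous)
      (HasCompactSupport.intro hcomp fun x hx => by simp [hsupp x hx])

theorem IsPolytope.surface_edge (h : IsPolytope P n c) {i j : ι} (hij : i ≠ j) :
    surface (m + 1) ({x | inner ℝ x (n j) = c j} ∩ {x | inner ℝ x (n i) = c i}) = 0 := by
  obtain ⟨ψ, h0, h1, hψ⟩ := exists_slab_coordinates (n i) (h.norm_eq i)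
  have hm : MeasurableSet {x : Pt (m + 1) | inner ℝ x (n j) = c j} :=
    (isClosed_eq (by fun_prop) continuous_const).measurableSet
  rw [← Measure.restrict_apply hm, surface_restrict_hyperplane (n i) (h.norm_eq i) ψ h0 h1,
    Measure.map_apply (by fun_prop) hm]
  exact h.volume_edge hij h1

theorem IsPolytope.surface_face_lt_top (h : IsPolytope P n c) (i : ι) :
    surface (m + 1) (P ∩ {x | inner ℝ x (n i) = c i}) < ⊤ := by
  obtain ⟨ψ, h0, h1, hψ⟩ := exists_slab_coordinates (n i) (h.norm_eq i)
  have hγ : Isometry fun z => c i • n i + ψ z := (isometry_add_left _).comp ψ.isometry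
  have hcomp : IsCompact P := Metric.isCompact_of_isClosed_isBounded h.isClosed h.bounded
  rw [← Measure.restrict_apply h.isClosed.measurableSet,
    surface_restrict_hyperplane (n i) (h.norm_eq i) ψ h0 h1,
    Measure.map_apply hγ.continuous.measurable h.isClosed.measurableSet]
  exact (hγ.isClosedEmbedding.isCompact_preimage hcomp).measure_lt_top

theorem IsPolytope.frontier_eq [Finite ι] {d : ℕ} {P : Set (Pt d)} {n : ι → Pt d}
    (h : IsPolytope P n c) : frontier P = ⋃ i, P ∩ {x | inner ℝ x (n i) = c i} := by
  rw [h.isClosed.frontier_eq]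
  ext x
  simp only [Set.mem_sdiff, Set.mem_iUnion, Set.mem_inter_iff, Set.mem_ofPred_eq, exists_and_left]
  refine and_congr_right fun hx => ⟨fun hni => ?_, ?_⟩
  · by_contra! hne
    refine hni (mem_interior_iff_mem_nhds.2 ?_)
    have : ∀ᶠ y in 𝓝 x, ∀ i, inner ℝ y (n i) < c i := by
      rw [eventually_all]
      intro i
      have hc : ContinuousAt (fun y : Pt d => inner ℝ y (n i)) x := by fun_prop
      exact hc.eventually_lt_const (lt_of_le_of_ne ((h.mem_iff x).1 hx i) (hne i))
    filter_upwards [this] with y hy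
    exact (h.mem_iff y).2 fun i => (hy i).le
  · rintro ⟨i, hi⟩ hint
    -- Moving outwards along `n i` violates constraint `i` at once.
    have hc : Tendsto (fun t : ℝ => x + t • n i) (𝓝[>] 0) (𝓝 x) := by
      have : Continuous fun t : ℝ => x + t • n i := by fun_prop
      simpa using (this.tendsto 0).mono_left nhdsWithin_le_nhds
    obtain ⟨t, ht, ht0⟩ := ((hc.eventually (mem_interior_iff_mem_nhds.1 hint)).and
      self_mem_nhdsWithin).exists
    have := (h.mem_iff _).1 ht i
    rw [inner_add_left, inner_smul_left, hi, real_inner_self_eq_norm_sq, h.norm_eq] at this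
    simp only [conj_trivial, one_pow, mul_one] at this
    exact absurd (Set.mem_Ioi.1 ht0) (by linarith)

end Polytope

/-- A simplex is where all barycentric coordinates are nonnegative; the outward normals are their
negated, normalised gradients. The face on which coordinate `i` vanishes is spanned by the other
vertices. -/
theorem cell_isPolytope {d : ℕ} (hd : 2 ≤ d) {K : Finset (Pt d)} (hK : K.card = d + 1)
    (hind : AffineIndependent ℝ ((↑) : K → Pt d)) :
    ∃ (n : K → Pt d) (c : K → ℝ), IsPolytope (cell K) n c ∧
      (∀ i j : K, i ≠ j → inner ℝ (j : Pt d) (n i) = c i) ∧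
      ∀ i : K, cell K ∩ {x | inner ℝ x (n i) = c i} ⊆ cell (K.erase i) := by
  classical
  have htop : affineSpan ℝ (Set.range ((↑) : K → Pt d)) = ⊤ := by
    rw [hind.affineSpan_eq_top_iff_card_eq_finrank_add_one]
    simp [hK]
  let b : AffineBasis K ℝ (Pt d) := ⟨(↑), hind, htop⟩
  have hb (i : K) : b i = i := rfl
  have hcell (x : Pt d) : x ∈ cell K ↔ ∀ i, 0 ≤ b.coord i x := by
    have := b.convexHull_eq_nonneg_coord
    have hr : Set.range b = (K : Set (Pt d)) := by
      ext y
      simp [hb]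
    rw [hr] at this
    rw [cell, this]
    rfl
  let L (i : K) : Pt d →L[ℝ] ℝ := LinearMap.toContinuousLinearMap (b.coord i).linear
  let g (i : K) : Pt d := (InnerProductSpace.toDual ℝ (Pt d)).symm (L i)
  have hg (i : K) (x : Pt d) : inner ℝ x (g i) = b.coord i x - b.coord i 0 := by
    rw [real_inner_comm, InnerProductSpace.toDual_symm_apply]
    have := (b.coord i).linearMap_vsub x 0
    simpa [L] using this
  -- Uses `2 ≤ d`. The edge from such a vertex `k` to `j` is parallel to face `i` but transversal to
  -- face `j`, so these faces are not parallel.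
  have hthird (i j : K) : ∃ k : K, k ≠ i ∧ k ≠ j := by
    have : 2 < Fintype.card K := by simp [hK]; omega
    obtain ⟨k, hk⟩ := Finset.exists_mem_notMem_of_card_lt_card (s := {i, j})
      (t := (Finset.univ : Finset K)) (Finset.card_le_two.trans_lt (by simpa using this))
    refine ⟨k, ?_⟩
    simpa using hk.2
  have hg0 (i : K) : g i ≠ 0 := by
    intro h
    obtain ⟨k, hk, -⟩ := hthird i i
    have h1 := hg i (b k)
    have h2 := hg i (b i)
    rw [h, inner_zero_right, b.coord_apply_ne hk.symm] at h1
    rw [h, inner_zero_right, b.coord_apply_eq] at h2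
    linarith
  have hgn (i : K) : 0 < ‖g i‖ := norm_pos_iff.2 (hg0 i)
  let n (i : K) : Pt d := -(‖g i‖⁻¹ • g i)
  let c (i : K) : ℝ := ‖g i‖⁻¹ * b.coord i 0
  have hnc (i : K) (x : Pt d) : c i - inner ℝ x (n i) = ‖g i‖⁻¹ * b.coord i x := by
    simp only [n, c, inner_neg_right, inner_smul_right, hg]
    ring
  have heq (i : K) (x : Pt d) : inner ℝ x (n i) = c i ↔ b.coord i x = 0 := by
    rw [eq_comm, ← sub_eq_zero, hnc]
    simp [hg0 i]
  refine ⟨n, c, ⟨fun x => ?_, fun i => ?_, ?_, fun i j hij => ?_⟩, fun i j hij => ?_, fun i x hx => ?_⟩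
  · rw [hcell]
    refine forall_congr' fun i => ?_
    rw [← sub_nonneg (b := inner ℝ x (n i)), hnc, mul_nonneg_iff_of_pos_left (inv_pos.2 (hgn i))]
  · simp [n, norm_smul, (hgn i).ne']
  · exact isBounded_convexHull.2 K.finite_toSet.isBounded
  · obtain ⟨k, hki, hkj⟩ := hthird i j
    refine ⟨(j : Pt d) - k, ?_, ?_⟩
    · rw [inner_sub_left, (heq i j).2 (b.coord_apply_ne hij), (heq i k).2 (b.coord_apply_ne hki.symm),
        sub_self]
    · rw [inner_sub_left, (heq j k).2 (b.coord_apply_ne hkj.symm), sub_ne_zero, Ne, heq j j,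
        ← hb j, b.coord_apply_eq]
      exact one_ne_zero
  · exact (heq i j).2 (b.coord_apply_ne hij)
  · have h0 := (heq i x).1 hx.2
    have h1 := (hcell x).1 hx.1
    have hs := b.sum_coord_apply_eq_one x
    rw [← Finset.add_sum_erase _ _ (Finset.mem_univ i), h0, zero_add] at hs
    have hx' := b.linear_combination_coord_eq_self x
    rw [← Finset.add_sum_erase _ _ (Finset.mem_univ i), h0, zero_smul, zero_add] at hx'
    rw [← hx']
    refine (convex_convexHull ℝ _).sum_mem (fun j _ => h1 j) hs fun j hj => subset_convexHull ℝ _ ?_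
    rw [Finset.mem_coe, Finset.mem_erase]
    exact ⟨fun h => Finset.ne_of_mem_erase hj (Subtype.ext h), j.2⟩

/-! ### Local shape at a boundary point and the outward normal -/

/-- Near `x`, the set `P` coincides with the half-space through `x` with outward normal `ν`. -/
def IsHalfspaceAt {d : ℕ} (P : Set (Pt d)) (x ν : Pt d) : Prop :=
  ‖ν‖ = 1 ∧ ∀ᶠ y in 𝓝 x, (y ∈ P ↔ inner ℝ (y - x) ν ≤ 0)

/-- Near `x`, the set `P` lies on one side of the hyperplane through `x` with normal `ν`, and
fills this side. -/
def IsOneSidedAt {d : ℕ} (S : Set (Pt d)) (x ν : Pt d) : Prop :=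
  ‖ν‖ = 1 ∧ ∀ᶠ y in 𝓝 x,
    (inner ℝ (y - x) ν < 0 → y ∈ S) ∧ (0 < inner ℝ (y - x) ν → y ∉ closure S)

section Local

variable {d : ℕ} {P S A B : Set (Pt d)} {x ν ν' : Pt d}

theorem tendsto_add_smul (x w : Pt d) :
    Tendsto (fun t : ℝ => x + t • w) (𝓝[>] 0) (𝓝 x) := by
  have : Continuous fun t : ℝ => x + t • w := by fun_prop
  simpa using (this.tendsto 0).mono_left nhdsWithin_le_nhds

theorem IsHalfspaceAt.isOneSidedAt (h : IsHalfspaceAt P x ν) (hP : IsClosed P) :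
    IsOneSidedAt P x ν := by
  refine ⟨h.1, h.2.mono fun y hy => ⟨fun h1 => hy.2 h1.le, fun h1 h2 => ?_⟩⟩
  rw [hP.closure_eq, hy] at h2
  linarith

theorem IsOneSidedAt.inner_nonpos (h : IsOneSidedAt S x ν) (h' : IsOutwardNormal S x ν') {w : Pt d}
    (hw : inner ℝ w ν < 0) : inner ℝ w ν' ≤ 0 := by
  by_contra! hpos
  have hw0 : 0 < ‖w‖ := norm_pos_iff.2 (by rintro rfl; simp at hw)
  -- With this `ε` the deviation allowed along the ray `x + t • w` is half of the actual value `t *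
  -- ⟪w, ν'⟫`.
  have h1 := h.2.and (h'.2 (inner ℝ w ν' / (2 * ‖w‖)) (by positivity))
  obtain ⟨t, ⟨ht1, ht2⟩, ht⟩ := (((tendsto_add_smul x w).eventually h1).and
    self_mem_nhdsWithin).exists
  simp only [add_sub_cancel_left, inner_smul_left, conj_trivial, norm_smul, Real.norm_eq_abs,
    abs_of_pos ht] at ht1 ht2
  have h3 := ht2.1 (ht1.1 (mul_neg_of_pos_of_neg ht hw))
  have h4 : inner ℝ w ν' / (2 * ‖w‖) * (t * ‖w‖) = t * inner ℝ w ν' / 2 := by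
    field_simp
  rw [h4] at h3
  nlinarith [mul_pos ht hpos]

theorem IsOneSidedAt.isOutwardNormal (h : IsOneSidedAt S x ν) : IsOutwardNormal S x ν := by
  refine ⟨h.1, fun ε hε => h.2.mono fun y hy => ⟨fun h1 => ?_, fun h1 => ?_⟩⟩
  · have : inner ℝ (y - x) ν ≤ 0 := not_lt.1 fun h2 => hy.2 h2 (subset_closure h1)
    exact this.trans (by positivity)
  · have : 0 ≤ inner ℝ (y - x) ν := not_lt.1 fun h2 => h1 (subset_closure (hy.1 h2))
    exact le_trans (neg_nonpos.2 (by positivity)) this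

/-- The normal field is defined by choice, so its value is known only through uniqueness. If `ν' ≠
ν`, the direction `ν' - ν` points strictly inwards for `ν` and strictly outwards for `ν'`. -/
theorem IsOneSidedAt.outwardNormal_eq (h : IsOneSidedAt S x ν) : outwardNormal S x = ν := by
  have hex : ∃ ν, IsOutwardNormal S x ν := ⟨ν, h.isOutwardNormal⟩
  rw [outwardNormal, dif_pos hex]
  set ν' := hex.choose
  have h' : IsOutwardNormal S x ν' := hex.choose_spec
  by_contra hne
  have hlt : inner ℝ ν' ν < 1 := inner_lt_one_iff_real_of_norm_eq_one h'.1 h.1 |>.2 hne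
  have := h.inner_nonpos h' (w := ν' - ν) (by
    rw [inner_sub_left, real_inner_self_eq_norm_sq, h.1]
    linarith)
  rw [inner_sub_left, real_inner_self_eq_norm_sq, h'.1, real_inner_comm] at this
  linarith

theorem norm_outwardNormal_le_one (S : Set (Pt d)) (x : Pt d) : ‖outwardNormal S x‖ ≤ 1 := by
  rw [outwardNormal]
  split_ifs with h
  · exact h.choose_spec.1.le
  · simp

/-- Near `x` the set contains an open piece of the intersection of two half-spaces, nonempty thanks
to the common inward direction `w`. -/
theorem volume_ne_zero_of_eventually {w : Pt d}
    (h : ∀ᶠ y in 𝓝 x, inner ℝ (y - x) ν < 0 → inner ℝ (y - x) ν' < 0 → y ∈ A)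
    (hw : inner ℝ w ν < 0) (hw' : inner ℝ w ν' < 0) : volume A ≠ 0 := by
  obtain ⟨O, hO, hOo, hxO⟩ := eventually_nhds_iff.1 h
  let U : Set (Pt d) := O ∩ {y | inner ℝ (y - x) ν < 0} ∩ {y | inner ℝ (y - x) ν' < 0}
  have hU : IsOpen U := (hOo.inter (isOpen_lt (by fun_prop) continuous_const)).inter
    (isOpen_lt (by fun_prop) continuous_const)
  obtain ⟨t, ht1, ht⟩ := (((tendsto_add_smul x w).eventually (hOo.mem_nhds hxO)).and
    self_mem_nhdsWithin).exists
  have hne : U.Nonempty := by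
    refine ⟨x + t • w, ⟨ht1, ?_⟩, ?_⟩
    · simpa [inner_smul_left] using mul_neg_of_pos_of_neg ht hw
    · simpa [inner_smul_left] using mul_neg_of_pos_of_neg ht hw'
  exact fun h0 => hU.measure_ne_zero volume hne
    (measure_mono_null (fun y hy => hO y hy.1.1 hy.1.2 hy.2) h0)

/-- Two sets on one side of a hyperplane each, with null intersection, lie on opposite sides of
the same hyperplane. -/
theorem IsOneSidedAt.eq_neg (hA : IsOneSidedAt A x ν) (hB : IsOneSidedAt B x ν')
    (hAB : volume (A ∩ B) = 0) : ν' = -ν := by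
  by_contra hne
  have hlt : inner ℝ ν' (-ν) < 1 :=
    (inner_lt_one_iff_real_of_norm_eq_one hB.1 (by rw [norm_neg, hA.1])).2 hne
  rw [inner_neg_right] at hlt
  -- The vector `-(ν + ν')` has the product `-(1 + ⟪ν, ν'⟫)` with both normals, which is negative
  -- unless `ν' = -ν`.
  refine volume_ne_zero_of_eventually (A := A ∩ B) (ν := ν) (ν' := ν')
    (w := -(ν + ν'))
    ((hA.2.and hB.2).mono fun y hy h1 h2 => ⟨hy.1.1 h1, hy.2.1 h2⟩) ?_ ?_ hAB
  · rw [inner_neg_left, inner_add_left, real_inner_self_eq_norm_sq, hA.1]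
    linarith
  · rw [inner_neg_left, inner_add_left, real_inner_self_eq_norm_sq, hB.1, real_inner_comm]
    linarith

theorem IsOneSidedAt.volume_inter_ne_zero (hA : IsOneSidedAt A x ν) (hB : x ∈ interior B) :
    volume (A ∩ B) ≠ 0 := by
  refine volume_ne_zero_of_eventually (A := A ∩ B) (ν := ν) (ν' := ν) (w := -ν)
    ((hA.2.and (mem_interior_iff_mem_nhds.1 hB)).mono fun y hy h1 _ => ⟨hy.1.1 h1, hy.2⟩) ?_ ?_ <;>
  · rw [inner_neg_left, real_inner_self_eq_norm_sq, hA.1]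
    norm_num

/-- The inactive constraints stay strict nearby, so only constraint `i` matters. -/
theorem IsPolytope.isHalfspaceAt {ι : Type*} [Finite ι] {n : ι → Pt d} {c : ι → ℝ}
    (h : IsPolytope P n c) (hx : x ∈ P) {i : ι} (hi : inner ℝ x (n i) = c i)
    (hj : ∀ j, j ≠ i → inner ℝ x (n j) ≠ c j) : IsHalfspaceAt P x (n i) := by
  refine ⟨h.norm_eq i, ?_⟩
  have : ∀ᶠ y in 𝓝 x, ∀ j, j ≠ i → inner ℝ y (n j) < c j := by
    rw [eventually_all]
    intro j
    by_cases hji : j = i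
    · exact Eventually.of_forall fun y h => absurd hji h
    have hc : ContinuousAt (fun y : Pt d => inner ℝ y (n j)) x := by fun_prop
    exact (hc.eventually_lt_const (lt_of_le_of_ne ((h.mem_iff x).1 hx j) (hj j hji))).mono
      fun y hy _ => hy
  filter_upwards [this] with y hy
  rw [inner_sub_left, hi, sub_nonpos, h.mem_iff]
  refine ⟨fun h1 => h1 i, fun h1 j => ?_⟩
  by_cases hji : j = i
  · exact hji ▸ h1
  · exact (hy j hji).le

end Local

/-! ### Simplices and their boundaries -/

section Cell

variable {d : ℕ} {K : Finset (Pt d)}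

theorem isCompact_cell (K : Finset (Pt d)) : IsCompact (cell K) :=
  K.finite_toSet.isCompact_convexHull ℝ

theorem isClosed_cell (K : Finset (Pt d)) : IsClosed (cell K) := (isCompact_cell K).isClosed

theorem bdry_subset_cell (K : Finset (Pt d)) : bdry K ⊆ cell K := (isClosed_cell K).frontier_subset

theorem isCompact_bdry (K : Finset (Pt d)) : IsCompact (bdry K) :=
  (isCompact_cell K).of_isClosed_subset isClosed_frontier (bdry_subset_cell K)

theorem measurableSet_bdry (K : Finset (Pt d)) : MeasurableSet (bdry K) :=
  (isCompact_bdry K).measurableSet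

theorem mem_bdry_iff {x : Pt d} : x ∈ bdry K ↔ x ∈ cell K ∧ x ∉ interior (cell K) := by
  rw [bdry, (isClosed_cell K).frontier_eq, Set.mem_sdiff]

/-- The exceptional points of face `i` lie on a second bounding hyperplane, hence on an edge, which
is null. -/
theorem IsPolytope.ae_isHalfspaceAt {ι : Type*} [Finite ι] {P : Set (Pt d)} {n : ι → Pt d}
    {c : ι → ℝ} (hd : d ≠ 0) (h : IsPolytope P n c) (i : ι) :
    ∀ᵐ x ∂(surface d), x ∈ P ∩ {x | inner ℝ x (n i) = c i} → IsHalfspaceAt P x (n i) := by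
  obtain ⟨m, rfl⟩ := Nat.exists_eq_succ_of_ne_zero hd
  have : ∀ᵐ x ∂(surface (m + 1)), ∀ j, j ≠ i →
      ¬ x ∈ {x | inner ℝ x (n j) = c j} ∩ {x | inner ℝ x (n i) = c i} := by
    rw [ae_all_iff]
    intro j
    by_cases hji : j = i
    · exact Eventually.of_forall fun y h => absurd hji h
    exact (measure_eq_zero_iff_ae_notMem.1 (h.surface_edge (Ne.symm hji))).mono fun x hx _ => hx
  filter_upwards [this] with x hx hxP
  exact h.isHalfspaceAt hxP.1 hxP.2 fun j hj h1 => hx j hj ⟨h1, hxP.2⟩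

theorem ae_exists_isHalfspaceAt (hd : 2 ≤ d) (hK : K.card = d + 1)
    (hind : AffineIndependent ℝ ((↑) : K → Pt d)) :
    ∀ᵐ x ∂(surface d), x ∈ bdry K → ∃ ν, IsHalfspaceAt (cell K) x ν := by
  obtain ⟨n, c, h, -, -⟩ := cell_isPolytope hd hK hind
  filter_upwards [ae_all_iff.2 fun i => h.ae_isHalfspaceAt (by omega) i] with x hx hxb
  rw [bdry, h.frontier_eq, Set.mem_iUnion] at hxb
  obtain ⟨i, hi⟩ := hxb
  exact ⟨n i, hx i hi⟩

theorem surface_bdry_lt_top (hd : 2 ≤ d) (hK : K.card = d + 1)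
    (hind : AffineIndependent ℝ ((↑) : K → Pt d)) : surface d (bdry K) < ⊤ := by
  obtain ⟨n, c, h, -, -⟩ := cell_isPolytope hd hK hind
  obtain ⟨m, rfl⟩ := Nat.exists_eq_succ_of_ne_zero (show d ≠ 0 by omega)
  rw [bdry, h.frontier_eq]
  exact (measure_iUnion_fintype_le _ _).trans_lt
    (ENNReal.sum_lt_top.2 fun i _ => h.surface_face_lt_top i)

theorem bdry_subset_iUnion_facets (hd : 2 ≤ d) (hK : K.card = d + 1)
    (hind : AffineIndependent ℝ ((↑) : K → Pt d)) : bdry K ⊆ ⋃ i : K, cell (K.erase i) := by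
  obtain ⟨n, c, h, -, h2⟩ := cell_isPolytope hd hK hind
  rw [bdry, h.frontier_eq]
  exact Set.iUnion_mono h2

/-- A field defined by choice has no measurability of its own, but this one is almost everywhere
constant on each of finitely many faces. -/
theorem aestronglyMeasurable_cellNormal (hd : 2 ≤ d) (hK : K.card = d + 1)
    (hind : AffineIndependent ℝ ((↑) : K → Pt d)) :
    AEStronglyMeasurable (cellNormal K) ((surface d).restrict (bdry K)) := by
  obtain ⟨n, c, h, -, -⟩ := cell_isPolytope hd hK hind
  rw [bdry, h.frontier_eq, aestronglyMeasurable_iUnion_iff]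
  intro i
  have hm : MeasurableSet (cell K ∩ {x | inner ℝ x (n i) = c i}) :=
    ((isClosed_cell K).inter (isClosed_eq (by fun_prop) continuous_const)).measurableSet
  refine (aestronglyMeasurable_const (b := n i)).congr ?_
  rw [EventuallyEq, ae_restrict_iff' hm]
  filter_upwards [h.ae_isHalfspaceAt (by omega) i] with x hx hxi
  exact (((hx hxi).isOneSidedAt (isClosed_cell K)).outwardNormal_eq).symm

theorem integrableOn_of_continuousOn_isCompact {s : Set (Pt d)} (hfin : surface d s < ⊤)
    (hs : IsCompact s) {φ : Pt d → ℝ} (hφ : ContinuousOn φ s) : IntegrableOn φ s (surface d) := by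
  obtain ⟨C, hC⟩ := hs.exists_bound_of_continuousOn hφ
  have : IsFiniteMeasure ((surface d).restrict s) := ⟨by simpa using hfin⟩
  exact Integrable.of_bound (hφ.aestronglyMeasurable hs.measurableSet) C
    (ae_restrict_of_forall_mem hs.measurableSet hC)

/-- The divergence theorem on a simplex. -/
theorem integral_fderiv_cell (hd : 2 ≤ d) (hK : K.card = d + 1)
    (hind : AffineIndependent ℝ ((↑) : K → Pt d)) {φ : Pt d → ℝ} (hφ : ContDiff ℝ 1 φ)
    (e : Pt d) :
    ∫ x in cell K, fderiv ℝ φ x e =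
      ∫ x in bdry K, φ x * inner ℝ (cellNormal K x) e ∂(surface d) := by
  have hfin := surface_bdry_lt_top hd hK hind
  have hmeas := aestronglyMeasurable_cellNormal hd hK hind
  have hint : IntegrableOn (fun x => φ x * inner ℝ (cellNormal K x) e) (bdry K) (surface d) := by
    have : IsFiniteMeasure ((surface d).restrict (bdry K)) := ⟨by simpa using hfin⟩
    have h1 : IntegrableOn φ (bdry K) (surface d) :=
      integrableOn_of_continuousOn_isCompact hfin (isCompact_bdry K) hφ.continuous.continuousOn
    refine h1.mul_bdd (c := ‖e‖) (hmeas.inner aestronglyMeasurable_const)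
      (Eventually.of_forall fun x => ?_)
    refine (norm_inner_le_norm _ _).trans ?_
    exact mul_le_of_le_one_left (norm_nonneg _) (norm_outwardNormal_le_one _ _)
  obtain ⟨n, c, h, -, -⟩ := cell_isPolytope hd hK hind
  obtain ⟨m, rfl⟩ := Nat.exists_eq_succ_of_ne_zero (show d ≠ 0 by omega)
  have hm (i : K) : MeasurableSet (cell K ∩ {x | inner ℝ x (n i) = c i}) :=
    ((isClosed_cell K).inter (isClosed_eq (by fun_prop) continuous_const)).measurableSet
  rw [h.integral_fderiv hφ e]
  rw [bdry, h.frontier_eq] at hint ⊢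
  -- Distinct faces overlap only in edges, so the boundary integral splits into face integrals.
  rw [integral_iUnion_ae (fun i => (hm i).nullMeasurableSet) ?_ hint, tsum_fintype]
  · refine Finset.sum_congr rfl fun i _ => ?_
    rw [← integral_const_mul]
    refine setIntegral_congr_ae (hm i) ?_
    filter_upwards [h.ae_isHalfspaceAt (by omega) i] with x hx hxi
    rw [cellNormal, ((hx hxi).isOneSidedAt (isClosed_cell K)).outwardNormal_eq, mul_comm]
  · intro i j hij
    change surface (m + 1) (_ ∩ _) = 0
    refine measure_mono_null (fun x hx => ?_) (h.surface_edge hij)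
    exact ⟨hx.2.2, hx.1.2⟩

end Cell

/-! ### Meshes and the cancellation of fluxes -/

/-- `T` is a triangulation of the closure of `Ω` by nonoverlapping simplices. -/
structure IsMesh {d : ℕ} (T : Finset (Finset (Pt d))) (Ω : Set (Pt d)) : Prop where
  card_eq : ∀ K ∈ T, K.card = d + 1
  indep : ∀ K ∈ T, AffineIndependent ℝ ((↑) : K → Pt d)
  volume_inter : ∀ K ∈ T, ∀ L ∈ T, K ≠ L → volume (cell K ∩ cell L) = 0
  closure_eq : closure Ω = ⋃ K ∈ T, cell K
  regular : interior (closure Ω) = Ω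

/-- Near `x`, the simplices of `T` that have `x` on their boundary are half-spaces. -/
def IsGenericPt {d : ℕ} (T : Finset (Finset (Pt d))) (x : Pt d) : Prop :=
  ∀ K ∈ T, x ∈ bdry K → ∃ ν, IsHalfspaceAt (cell K) x ν

theorem bdry_subset_skeleton {d : ℕ} {T : Finset (Finset (Pt d))} {K : Finset (Pt d)}
    (hK : K ∈ T) : bdry K ⊆ skeleton T :=
  Set.subset_biUnion_of_mem (u := fun K => bdry K) (show K ∈ (T : Set (Finset (Pt d))) from hK)

/-- Some vertex `i` of `K` is not in `L`. By conformity the intersection is spanned by common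
vertices, all of which lie in the hyperplane of the facet opposite to `i`. -/
theorem volume_cell_inter {d : ℕ} (hd : 2 ≤ d) {K L : Finset (Pt d)} (hK : K.card = d + 1)
    (hL : L.card = d + 1) (hind : AffineIndependent ℝ ((↑) : K → Pt d)) (hne : K ≠ L)
    (hKL : cell K ∩ cell L = convexHull ℝ ((K : Set (Pt d)) ∩ (L : Set (Pt d)))) :
    volume (cell K ∩ cell L) = 0 := by
  obtain ⟨n, c, h, h1, -⟩ := cell_isPolytope hd hK hind
  obtain ⟨i, hiK, hiL⟩ : ∃ i ∈ K, i ∉ L := by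
    by_contra! hsub
    exact hne (Finset.eq_of_subset_of_card_le hsub (by omega))
  rw [hKL]
  refine measure_mono_null (convexHull_min (fun y hy => ?_) ?_)
    (volume_hyperplane (h.norm_eq ⟨i, hiK⟩) (c ⟨i, hiK⟩))
  · refine h1 ⟨i, hiK⟩ ⟨y, hy.1⟩ fun h2 => hiL ?_
    rw [Subtype.mk.injEq] at h2
    exact h2 ▸ hy.2
  · intro x hx y hy a b _ _ hab
    simp only [Set.mem_ofPred_eq] at hx hy ⊢
    rw [inner_add_left, inner_smul_left, inner_smul_left, hx, hy, conj_trivial, conj_trivial,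
      ← add_mul, hab, one_mul]

theorem MeshedDomain.IsAdmissible.isMesh_s {d : ℕ} {G : MeshedDomain d} (hG : G.IsAdmissible)
    (hd : 2 ≤ d) : IsMesh G.Ts G.Ωs where
  card_eq K hK := hG.card_eq K (.inl hK)
  indep K hK := hG.indep K (.inl hK)
  volume_inter K hK L hL hne := volume_cell_inter hd (hG.card_eq K (.inl hK))
    (hG.card_eq L (.inl hL)) (hG.indep K (.inl hK)) hne (hG.conforming K L (.inl hK) (.inl hL))
  closure_eq := hG.cover_s
  regular := hG.regular_s

theorem MeshedDomain.IsAdmissible.isMesh_d {d : ℕ} {G : MeshedDomain d} (hG : G.IsAdmissible)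
    (hd : 2 ≤ d) : IsMesh G.Td G.Ωd where
  card_eq K hK := hG.card_eq K (.inr hK)
  indep K hK := hG.indep K (.inr hK)
  volume_inter K hK L hL hne := volume_cell_inter hd (hG.card_eq K (.inr hK))
    (hG.card_eq L (.inr hL)) (hG.indep K (.inr hK)) hne (hG.conforming K L (.inr hK) (.inr hL))
  closure_eq := hG.cover_d
  regular := hG.regular_d

namespace IsMesh

variable {d : ℕ} {T : Finset (Finset (Pt d))} {Ω : Set (Pt d)} {x : Pt d}

theorem isOpen (h : IsMesh T Ω) : IsOpen Ω := h.regular ▸ isOpen_interior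

theorem cell_subset (h : IsMesh T Ω) {K : Finset (Pt d)} (hK : K ∈ T) : cell K ⊆ closure Ω := by
  rw [h.closure_eq]
  exact Set.subset_biUnion_of_mem (u := fun K => cell K)
    (show K ∈ (T : Set (Finset (Pt d))) from hK)

theorem interior_cell_subset (h : IsMesh T Ω) {K : Finset (Pt d)} (hK : K ∈ T) :
    interior (cell K) ⊆ Ω := by
  conv_rhs => rw [← h.regular]
  exact interior_mono (h.cell_subset hK)

theorem volume_restrict_cell_le (h : IsMesh T Ω) {K : Finset (Pt d)} (hK : K ∈ T) :
    volume.restrict (cell K) ≤ volume.restrict Ω := by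
  have h0 : volume (frontier (cell K)) = 0 := (convex_convexHull ℝ _).addHaar_frontier volume
  have h1 : interior (cell K) =ᵐ[volume] cell K := interior_ae_eq_of_null_frontier h0
  rw [← Measure.restrict_congr_set h1]
  exact Measure.restrict_mono_set _ (h.interior_cell_subset hK)

theorem mem_frontier_iff (h : IsMesh T Ω) : x ∈ frontier Ω ↔ x ∈ closure Ω ∧ x ∉ Ω := by
  rw [h.isOpen.frontier_eq, Set.mem_sdiff]

theorem ae_isGenericPt (h : IsMesh T Ω) (hd : 2 ≤ d) : ∀ᵐ x ∂(surface d), IsGenericPt T x := by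
  unfold IsGenericPt
  exact (ae_ball_iff T.countable_toSet).2 fun K hK =>
    ae_exists_isHalfspaceAt hd (h.card_eq K hK) (h.indep K hK)

theorem exists_bdry_of_mem_frontier (h : IsMesh T Ω) (hx : x ∈ frontier Ω) :
    ∃ K ∈ T, x ∈ bdry K := by
  obtain ⟨hx1, hx2⟩ := h.mem_frontier_iff.1 hx
  rw [h.closure_eq, Set.mem_iUnion₂] at hx1
  obtain ⟨K, hK, hxK⟩ := hx1
  exact ⟨K, hK, mem_bdry_iff.2 ⟨hxK, fun h1 => hx2 (h.interior_cell_subset hK h1)⟩⟩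

theorem frontier_subset_skeleton (h : IsMesh T Ω) : frontier Ω ⊆ skeleton T := fun _ hx => by
  obtain ⟨K, hK, hxK⟩ := h.exists_bdry_of_mem_frontier hx
  exact bdry_subset_skeleton hK hxK

theorem eventually_closure_iff (h : IsMesh T Ω) {K : Finset (Pt d)} (hK : K ∈ T)
    (honly : ∀ L ∈ T, L ≠ K → x ∉ cell L) : ∀ᶠ y in 𝓝 x, (y ∈ closure Ω ↔ y ∈ cell K) := by
  have : ∀ᶠ y in 𝓝 x, ∀ L ∈ T, L ≠ K → y ∉ cell L := by
    rw [eventually_all_finset]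
    intro L hL
    by_cases hLK : L = K
    · exact Eventually.of_forall fun y h => absurd hLK h
    have hL : ∀ᶠ y in 𝓝 x, y ∈ (cell L)ᶜ :=
      (isClosed_cell L).isOpen_compl.mem_nhds (honly L hL hLK)
    exact hL.mono fun y hy _ => hy
  filter_upwards [this] with y hy
  refine ⟨fun h1 => ?_, fun h1 => h.cell_subset hK h1⟩
  rw [h.closure_eq, Set.mem_iUnion₂] at h1
  obtain ⟨L, hL, hyL⟩ := h1
  by_cases hLK : L = K
  · exact hLK ▸ hyL
  · exact absurd hyL (hy L hL hLK)

theorem normal_eq_neg (h : IsMesh T Ω) {K L : Finset (Pt d)} (hK : K ∈ T) (hL : L ∈ T)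
    (hne : L ≠ K) {ν ν' : Pt d} (hν : IsHalfspaceAt (cell K) x ν)
    (hν' : IsHalfspaceAt (cell L) x ν') : ν' = -ν :=
  (hν.isOneSidedAt (isClosed_cell K)).eq_neg (hν'.isOneSidedAt (isClosed_cell L))
    (h.volume_inter K hK L hL hne.symm)

/-- Two opposite half-spaces fill a neighbourhood of `x`, and regularity of `Ω` excludes a crack
there. -/
theorem mem_of_two_cells (h : IsMesh T Ω) {K L : Finset (Pt d)} (hK : K ∈ T) (hL : L ∈ T)
    (hne : L ≠ K) {ν ν' : Pt d} (hν : IsHalfspaceAt (cell K) x ν)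
    (hν' : IsHalfspaceAt (cell L) x ν') : x ∈ Ω := by
  have h1 := h.normal_eq_neg hK hL hne hν hν'
  rw [← h.regular, mem_interior_iff_mem_nhds]
  filter_upwards [hν.2, hν'.2] with y hy hy'
  rcases le_total (inner ℝ (y - x) ν) 0 with h2 | h2
  · exact h.cell_subset hK (hy.2 h2)
  · refine h.cell_subset hL (hy'.2 ?_)
    rw [h1, inner_neg_right]
    linarith

/-- At a generic boundary point, the domain coincides with the only simplex that contains it. -/
theorem exists_isOneSidedAt (h : IsMesh T Ω) (hgen : IsGenericPt T x) (hx : x ∈ frontier Ω) :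
    ∃ K ∈ T, ∃ ν, x ∈ bdry K ∧ IsHalfspaceAt (cell K) x ν ∧ IsOneSidedAt Ω x ν ∧
      ∀ L ∈ T, L ≠ K → x ∉ cell L := by
  obtain ⟨K, hK, hxK⟩ := h.exists_bdry_of_mem_frontier hx
  obtain ⟨ν, hν⟩ := hgen K hK hxK
  have hxΩ := (h.mem_frontier_iff.1 hx).2
  have honly : ∀ L ∈ T, L ≠ K → x ∉ cell L := by
    intro L hL hLK hxL
    obtain ⟨ν', hν'⟩ := hgen L hL
      (mem_bdry_iff.2 ⟨hxL, fun h1 => hxΩ (h.interior_cell_subset hL h1)⟩)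
    exact hxΩ (h.mem_of_two_cells hK hL hLK hν hν')
  refine ⟨K, hK, ν, hxK, hν, ⟨hν.1, ?_⟩, honly⟩
  -- The local description concerns `closure Ω`. To reach `Ω` itself, a point strictly on the inner
  -- side is shown to be interior to `K`; hence the half-space description is needed around `y` too.
  filter_upwards [h.eventually_closure_iff hK honly, eventually_eventually_nhds.2 hν.2]
    with y hy hy'
  refine ⟨fun h1 => h.interior_cell_subset hK (mem_interior_iff_mem_nhds.2 ?_), fun h1 => ?_⟩
  · have hc : ContinuousAt (fun y : Pt d => inner ℝ (y - x) ν) y := by fun_prop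
    filter_upwards [hy', hc.eventually_lt_const h1] with z hz hz'
    exact hz.2 hz'.le
  · rw [hy, hy'.self_of_nhds]
    linarith

/-- At a generic point of the boundary exactly one simplex is present and shares its normal with
`Ω`. A generic skeleton point inside `Ω` belongs to exactly two simplices, with opposite normals. -/
theorem sum_indicator_cellNormal (h : IsMesh T Ω) (hgen : IsGenericPt T x) :
    ∑ K ∈ T, (bdry K).indicator (cellNormal K) x = (frontier Ω).indicator (outwardNormal Ω) x := by
  by_cases hx : x ∈ frontier Ω
  · obtain ⟨K, hK, ν, hxK, hν, hΩ, honly⟩ := h.exists_isOneSidedAt hgen hx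
    rw [Set.indicator_of_mem hx, hΩ.outwardNormal_eq, Finset.sum_eq_single_of_mem K hK,
      Set.indicator_of_mem hxK, cellNormal, (hν.isOneSidedAt (isClosed_cell K)).outwardNormal_eq]
    exact fun L hL hLK => Set.indicator_of_notMem
      (fun h1 => honly L hL hLK (bdry_subset_cell L h1)) _
  rw [Set.indicator_of_notMem hx]
  by_cases hB : ∃ K ∈ T, x ∈ bdry K
  swap
  · push Not at hB
    exact Finset.sum_eq_zero fun K hK => Set.indicator_of_notMem (hB K hK) _
  obtain ⟨K, hK, hxK⟩ := hB
  obtain ⟨ν, hν⟩ := hgen K hK hxK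
  have hν1 := hν.isOneSidedAt (isClosed_cell K)
  have hxΩ : x ∈ Ω := by
    by_contra h1
    exact hx (h.mem_frontier_iff.2 ⟨h.cell_subset hK (bdry_subset_cell K hxK), h1⟩)
  -- Were `K` alone at `x`, a neighbourhood of `x` in `Ω` would lie in `K`, although `x` is on its
  -- boundary.
  obtain ⟨L, hL, hLK, hxL⟩ : ∃ L ∈ T, L ≠ K ∧ x ∈ cell L := by
    by_contra! honly
    refine (mem_bdry_iff.1 hxK).2 (mem_interior_iff_mem_nhds.2 ?_)
    filter_upwards [h.eventually_closure_iff hK honly, h.isOpen.mem_nhds hxΩ] with y hy hy'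
    exact hy.1 (subset_closure hy')
  -- If `x` were interior to `L`, the local half-space of `K` would overlap `L` in positive volume.
  have hxLb : x ∈ bdry L := mem_bdry_iff.2 ⟨hxL, fun h1 =>
    hν1.volume_inter_ne_zero h1 (h.volume_inter K hK L hL hLK.symm)⟩
  obtain ⟨ν', hν'⟩ := hgen L hL hxLb
  have hneg := h.normal_eq_neg hK hL hLK hν hν'
  rw [Finset.sum_eq_add_of_mem K L hK hL hLK.symm, Set.indicator_of_mem hxK,
    Set.indicator_of_mem hxLb, cellNormal, cellNormal, hν1.outwardNormal_eq,
    (hν'.isOneSidedAt (isClosed_cell L)).outwardNormal_eq, hneg, add_neg_cancel]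
  -- A third simplex would have its normal opposite both to `ν` and to `-ν`.
  intro M hM hMne
  refine Set.indicator_of_notMem (fun hxM => ?_) _
  obtain ⟨ν'', hν''⟩ := hgen M hM hxM
  have h1 := h.normal_eq_neg hK hM hMne.1 hν hν''
  have h2 := h.normal_eq_neg hL hM hMne.2 hν' hν''
  rw [hneg, neg_neg, h1] at h2
  have h3 : ν = 0 := by
    rw [neg_eq_iff_add_eq_zero, ← two_smul ℝ, smul_eq_zero] at h2
    simpa using h2
  simpa [h3] using hν.1

theorem aestronglyMeasurable_indicator_cellNormal (h : IsMesh T Ω) (hd : 2 ≤ d)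
    {K : Finset (Pt d)} (hK : K ∈ T) :
    AEStronglyMeasurable ((bdry K).indicator (cellNormal K)) (surface d) :=
  (aestronglyMeasurable_indicator_iff (measurableSet_bdry K)).2
    (aestronglyMeasurable_cellNormal hd (h.card_eq K hK) (h.indep K hK))

/-- The field agrees almost everywhere with a finite sum of measurable cell normals. -/
theorem aestronglyMeasurable_outwardNormal (h : IsMesh T Ω) (hd : 2 ≤ d) :
    AEStronglyMeasurable (outwardNormal Ω) ((surface d).restrict (frontier Ω)) := by
  rw [← aestronglyMeasurable_indicator_iff isClosed_frontier.measurableSet]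
  refine (Finset.aestronglyMeasurable_fun_sum T fun K hK =>
    h.aestronglyMeasurable_indicator_cellNormal hd hK).congr ?_
  filter_upwards [h.ae_isGenericPt hd] with x hx using h.sum_indicator_cellNormal hx

theorem integrableOn_inner_cellNormal (h : IsMesh T Ω) (hd : 2 ≤ d) {F : Pt d → Pt d}
    {K : Finset (Pt d)} (hK : K ∈ T) (hFK : IntegrableOn F (bdry K) (surface d)) :
    IntegrableOn (fun x => inner ℝ (F x) (cellNormal K x)) (bdry K) (surface d) := by
  refine hFK.norm.mono' (hFK.aestronglyMeasurable.inner
    (aestronglyMeasurable_cellNormal hd (h.card_eq K hK) (h.indep K hK)))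
    (Eventually.of_forall fun x => ?_)
  exact (norm_inner_le_norm _ _).trans
    (mul_le_of_le_one_right (norm_nonneg _) (norm_outwardNormal_le_one _ _))

/-- The fluxes through the interior facets cancel. -/
theorem sum_flux (h : IsMesh T Ω) (hd : 2 ≤ d) {F : Pt d → Pt d}
    (hF : IntegrableOn F (skeleton T) (surface d)) :
    ∑ K ∈ T, ∫ x in bdry K, inner ℝ (F x) (cellNormal K x) ∂(surface d) =
      ∫ x in frontier Ω, inner ℝ (F x) (outwardNormal Ω x) ∂(surface d) := by
  have h1 (K : Finset (Pt d)) (x : Pt d) : (bdry K).indicator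
      (fun x => inner ℝ (F x) (cellNormal K x)) x =
      inner ℝ (F x) ((bdry K).indicator (cellNormal K) x) := by
    by_cases hx : x ∈ bdry K <;> simp [hx]
  have h2 (x : Pt d) : (frontier Ω).indicator
      (fun x => inner ℝ (F x) (outwardNormal Ω x)) x =
      inner ℝ (F x) ((frontier Ω).indicator (outwardNormal Ω) x) := by
    by_cases hx : x ∈ frontier Ω <;> simp [hx]
  rw [← integral_indicator isClosed_frontier.measurableSet]
  simp only [← integral_indicator (measurableSet_bdry _)]
  rw [← integral_finsetSum _ fun K hK => (integrable_indicator_iff (measurableSet_bdry K)).2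
    (h.integrableOn_inner_cellNormal hd hK (hF.mono_set (bdry_subset_skeleton hK)))]
  refine integral_congr_ae ?_
  filter_upwards [h.ae_isGenericPt hd] with x hx
  simp only [h1, h2]
  rw [← inner_sum, h.sum_indicator_cellNormal hx]

end IsMesh

/-- The outward normals of two disjoint meshed domains are opposite on their interface. -/
theorem ae_outwardNormal_eq_neg {d : ℕ} (hd : 2 ≤ d) {T T' : Finset (Finset (Pt d))}
    {Ω Ω' : Set (Pt d)} (h : IsMesh T Ω) (h' : IsMesh T' Ω') (hdis : Disjoint Ω Ω') :
    ∀ᵐ x ∂(surface d), x ∈ frontier Ω → x ∈ frontier Ω' →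
      outwardNormal Ω' x = -outwardNormal Ω x := by
  filter_upwards [h.ae_isGenericPt hd, h'.ae_isGenericPt hd] with x hx hx' hxf hxf'
  obtain ⟨K, -, ν, -, -, hν, -⟩ := h.exists_isOneSidedAt hx hxf
  obtain ⟨L, -, ν', -, -, hν', -⟩ := h'.exists_isOneSidedAt hx' hxf'
  rw [hν.outwardNormal_eq, hν'.outwardNormal_eq]
  exact hν.eq_neg hν' (by rw [hdis.inter_eq, measure_empty])

/-! ### Square-integrable functions and Green's formula -/

theorem tendsto_integral_mul_of_tendsto_eLpNorm {α : Type*} [MeasurableSpace α] {μ : Measure α}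
    {f : ℕ → α → ℝ} {w v : α → ℝ} (hf : ∀ n, AEStronglyMeasurable (f n) μ) (hw : MemLp w 2 μ)
    (hv : MemLp v 2 μ) (h : Tendsto (fun n => eLpNorm (fun x => f n x - w x) 2 μ) atTop (𝓝 0)) :
    Tendsto (fun n => ∫ x, f n x * v x ∂μ) atTop (𝓝 (∫ x, w x * v x ∂μ)) := by
  have hd (n : ℕ) : AEStronglyMeasurable (fun x => f n x - w x) μ := (hf n).sub hw.1
  refine tendsto_integral_of_L1' _ (hw.integrable_mul hv).1 ?_ ?_
  -- The approximants are not assumed square integrable; from some index on they differ from `w` by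
  -- a function of finite norm.
  · filter_upwards [h.eventually_lt_const (show (0 : ENNReal) < ⊤ by simp)] with n hn
    have h1 : MemLp (fun x => f n x - w x) 2 μ := ⟨hd n, hn⟩
    have h2 := h1.add hw
    have h3 : ((fun x => f n x - w x) + w) = f n := by
      ext x
      simp
    rw [h3] at h2
    exact h2.integrable_mul hv
  · have h1 := ENNReal.Tendsto.mul_const h (b := eLpNorm v 2 μ) (Or.inr hv.2.ne)
    rw [zero_mul] at h1
    refine tendsto_of_tendsto_of_tendsto_of_le_of_le tendsto_const_nhds h1 (fun _ => zero_le) fun n => ?_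
    have h2 := eLpNorm_smul_le_mul_eLpNorm (p := 2) (q := 2) (r := 1) hv.1 (hd n)
    refine le_trans (le_of_eq ?_) h2
    congr 1
    ext x
    simp [sub_mul]

theorem IsPoly.contDiff {d k : ℕ} {w : Pt d → ℝ} (h : IsPoly k w) : ContDiff ℝ ∞ w := by
  obtain ⟨P, -, hP⟩ := h
  rw [funext hP]
  clear hP
  induction P using MvPolynomial.induction_on with
  | C a => simpa using contDiff_const
  | add p q hp hq => simpa using hp.add hq
  | mul_X p i hp =>
    have : ContDiff ℝ ∞ fun x : Pt d => x i := by fun_prop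
    simpa using hp.mul this

theorem inner_eq_sum {d : ℕ} (x y : Pt d) : inner ℝ x y = ∑ i, x i * y i := by
  simp [PiLp.inner_apply, mul_comm]

theorem memLp_two_iUnion {α ι : Type*} [MeasurableSpace α] [Finite ι] {μ : Measure α}
    {s : ι → Set α} {f : α → ℝ} (h : ∀ i, MemLp f 2 (μ.restrict (s i))) :
    MemLp f 2 (μ.restrict (⋃ i, s i)) := by
  have hm : AEStronglyMeasurable f (μ.restrict (⋃ i, s i)) :=
    aestronglyMeasurable_iUnion_iff.2 fun i => (h i).1
  rw [memLp_two_iff_integrable_sq hm]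
  exact integrableOn_finite_iUnion.2 fun i => (memLp_two_iff_integrable_sq (h i).1).1 (h i)

section Green

variable {d : ℕ} {T : Finset (Finset (Pt d))} {Ω : Set (Pt d)} {K : Finset (Pt d)}

theorem memLp_bdry_of_continuous (hd : 2 ≤ d) (h : IsMesh T Ω) (hK : K ∈ T) {v : Pt d → ℝ}
    (hv : Continuous v) : MemLp v 2 ((surface d).restrict (bdry K)) := by
  rw [memLp_two_iff_integrable_sq hv.aestronglyMeasurable]
  exact integrableOn_of_continuousOn_isCompact
    (surface_bdry_lt_top hd (h.card_eq K hK) (h.indep K hK)) (isCompact_bdry K)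
    (hv.pow 2).continuousOn

theorem memLp_cell_of_continuous (K : Finset (Pt d)) {v : Pt d → ℝ}
    (hv : Continuous v) : MemLp v 2 (volume.restrict (cell K)) := by
  rw [memLp_two_iff_integrable_sq hv.aestronglyMeasurable]
  exact (hv.pow 2).continuousOn.integrableOn_compact (isCompact_cell K)

theorem memLp_skeleton (hd : 2 ≤ d) (h : IsMesh T Ω) {k : ℕ} {q : Pt d → ℝ}
    (hq : InQbar k T q) : MemLp q 2 ((surface d).restrict (skeleton T)) := by
  -- Discrete data are polynomial on each facet only, so each boundary is cut into facets. The
  -- factor `bdry K` provides finite surface measure.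
  have hs : skeleton T ⊆ ⋃ K : T, ⋃ i : (K : Finset (Pt d)),
      (bdry (K : Finset (Pt d)) ∩ cell ((K : Finset (Pt d)).erase i)) := by
    intro x hx
    obtain ⟨K, hK, hxK⟩ := Set.mem_iUnion₂.1 hx
    obtain ⟨i, hi⟩ := Set.mem_iUnion.1
      (bdry_subset_iUnion_facets hd (h.card_eq K hK) (h.indep K hK) hxK)
    exact Set.mem_iUnion.2 ⟨⟨K, hK⟩, Set.mem_iUnion.2 ⟨i, hxK, hi⟩⟩
  refine MemLp.mono_measure (Measure.restrict_mono_set _ hs) ?_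
  refine memLp_two_iUnion fun K => memLp_two_iUnion fun i => ?_
  obtain ⟨w, hw, hqw⟩ := hq ((K : Finset (Pt d)).erase i)
    ⟨by rw [Finset.card_erase_of_mem i.2, h.card_eq K K.2, Nat.add_sub_cancel], K, K.2,
      Finset.erase_subset _ _⟩
  have h1 := (memLp_bdry_of_continuous hd h K.2 hw.contDiff.continuous).mono_measure
    (Measure.restrict_mono_set (surface d) (Set.inter_subset_left
      (t := cell ((K : Finset (Pt d)).erase i))))
  refine h1.ae_eq ?_
  exact (ae_restrict_of_ae_restrict_of_subset Set.inter_subset_right hqw).mono fun x hx => hx.symm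

theorem memLp_mul_cellNormal (hd : 2 ≤ d) (h : IsMesh T Ω) (hK : K ∈ T) {v : Pt d → ℝ}
    (hv : MemLp v 2 ((surface d).restrict (bdry K))) (j : Fin d) :
    MemLp (fun x => v x * cellNormal K x j) 2 ((surface d).restrict (bdry K)) := by
  have hm : AEStronglyMeasurable (fun x => cellNormal K x j) ((surface d).restrict (bdry K)) :=
    (EuclideanSpace.proj (𝕜 := ℝ) j).continuous.comp_aestronglyMeasurable
      (aestronglyMeasurable_cellNormal hd (h.card_eq K hK) (h.indep K hK))
  refine hv.of_le (hv.1.mul hm) (Eventually.of_forall fun x => ?_)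
  rw [norm_mul]
  exact mul_le_of_le_one_right (norm_nonneg _)
    ((PiLp.norm_apply_le _ j).trans (norm_outwardNormal_le_one _ _))

theorem green_smooth (hd : 2 ≤ d) (h : IsMesh T Ω) (hK : K ∈ T) {φ v : Pt d → ℝ}
    (hφ : ContDiff ℝ 1 φ) (hv : ContDiff ℝ 1 v) (j : Fin d) :
    (∫ x in cell K, partialDeriv j φ x * v x) + ∫ x in cell K, φ x * partialDeriv j v x =
      ∫ x in bdry K, φ x * (v x * cellNormal K x j) ∂(surface d) := by
  have h1 := integral_fderiv_cell hd (h.card_eq K hK) (h.indep K hK) (hφ.mul hv)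
    (EuclideanSpace.single j 1)
  have hc {f g : Pt d → ℝ} (hf : Continuous f) (hg : ContDiff ℝ 1 g) :
      IntegrableOn (fun x => f x * partialDeriv j g x) (cell K) :=
    (hf.mul ((hg.continuous_fderiv one_ne_zero).clm_apply
      continuous_const)).continuousOn.integrableOn_compact (isCompact_cell K)
  have h2 := hc hv.continuous hφ
  simp only [mul_comm (v _)] at h2
  rw [← integral_add h2 (hc hφ.continuous hv)]
  refine Eq.trans (integral_congr_ae (Eventually.of_forall fun x => ?_)) (h1.trans
    (integral_congr_ae (Eventually.of_forall fun x => ?_)))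
  · change _ = fderiv ℝ (fun x => φ x * v x) x (EuclideanSpace.single j 1)
    rw [fderiv_fun_mul (hφ.differentiable one_ne_zero x) (hv.differentiable one_ne_zero x)]
    simp only [partialDeriv, add_apply, smul_apply, smul_eq_mul]
    ring
  · simp [EuclideanSpace.inner_single_right, mul_assoc]

/-- Green's formula on a simplex for a Sobolev function with a trace on the mesh skeleton. -/
theorem green (hd : 2 ≤ d) (h : IsMesh T Ω) (hK : K ∈ T) {w : Pt d → ℝ} {Dw : Pt d → Fin d → ℝ}
    {τ v : Pt d → ℝ} (hw : IsH1 Ω w Dw) (hτ : IsTrace Ω (skeleton T) w Dw τ)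
    (hv : ContDiff ℝ 1 v) (j : Fin d) :
    (∫ x in cell K, Dw x j * v x) + ∫ x in cell K, w x * partialDeriv j v x =
      ∫ x in bdry K, τ x * (v x * cellNormal K x j) ∂(surface d) := by
  obtain ⟨hτm, φ, hφ, h1, h2, h3⟩ := hτ
  have hφ1 (n : ℕ) : ContDiff ℝ 1 (φ n) := (hφ n).of_le (by simp)
  have hμ := h.volume_restrict_cell_le hK
  have hs : (surface d).restrict (bdry K) ≤ (surface d).restrict (skeleton T) :=
    Measure.restrict_mono_set _ (bdry_subset_skeleton hK)
  have hpc {g : Pt d → ℝ} (hg : ContDiff ℝ 1 g) : Continuous (partialDeriv j g) :=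
    (hg.continuous_fderiv one_ne_zero).clm_apply continuous_const
  have hle {μ ν : Measure (Pt d)} (hμν : μ ≤ ν) {f : ℕ → Pt d → ℝ}
      (hf : Tendsto (fun n => eLpNorm (f n) 2 ν) atTop (𝓝 0)) :
      Tendsto (fun n => eLpNorm (f n) 2 μ) atTop (𝓝 0) :=
    tendsto_of_tendsto_of_tendsto_of_le_of_le tendsto_const_nhds hf (fun _ => zero_le)
      fun n => eLpNorm_mono_measure _ hμν
  have t1 := tendsto_integral_mul_of_tendsto_eLpNorm
    (fun n => (hpc (hφ1 n)).aestronglyMeasurable) ((hw.memLp_grad j).mono_measure hμ)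
    (memLp_cell_of_continuous K hv.continuous) (hle hμ (h2 j))
  have t2 := tendsto_integral_mul_of_tendsto_eLpNorm
    (fun n => (hφ1 n).continuous.aestronglyMeasurable) (hw.memLp.mono_measure hμ)
    (memLp_cell_of_continuous K (hpc hv)) (hle hμ h1)
  have t3 := tendsto_integral_mul_of_tendsto_eLpNorm
    (fun n => (hφ1 n).continuous.aestronglyMeasurable) (hτm.mono_measure hs)
    (memLp_mul_cellNormal hd h hK (memLp_bdry_of_continuous hd h hK hv.continuous) j) (hle hs h3)
  exact tendsto_nhds_unique (t1.add t2)
    (t3.congr fun n => (green_smooth hd h hK (hφ1 n) hv j).symm)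

end Green

/-! ### Fluxes through the interface -/

section Interface

variable {d : ℕ} {T : Finset (Finset (Pt d))} {Ω Ω₁ Ω₂ : Set (Pt d)}

theorem interface_subset_frontier (h₁ : IsOpen Ω₁) (hdis : Disjoint Ω₁ Ω₂) :
    closure Ω₁ ∩ closure Ω₂ ⊆ frontier Ω₁ := fun x hx => by
  rw [h₁.frontier_eq]
  exact ⟨hx.1, fun h => Set.disjoint_left.1 (hdis.closure_right h₁) h hx.2⟩

/-- A boundary point of `Ω₁` that is away from `Ω₂` but inside `Ω` would have a neighbourhood in
`closure Ω₁`, hence belong to `Ω₁`. -/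
theorem frontier_subset_interface (h₁ : interior (closure Ω₁) = Ω₁) (h : interior (closure Ω) = Ω)
    (hcl : closure Ω = closure Ω₁ ∪ closure Ω₂) :
    frontier Ω₁ ⊆ closure Ω₁ ∩ closure Ω₂ ∪ frontier Ω₁ ∩ frontier Ω := by
  have ho : IsOpen Ω := h ▸ isOpen_interior
  have ho₁ : IsOpen Ω₁ := h₁ ▸ isOpen_interior
  intro x hx
  by_cases h2 : x ∈ closure Ω₂
  · exact .inl ⟨frontier_subset_closure hx, h2⟩
  refine .inr ⟨hx, ?_⟩
  rw [ho.frontier_eq, hcl]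
  refine ⟨.inl (frontier_subset_closure hx), fun hxΩ => ?_⟩
  rw [ho₁.frontier_eq] at hx
  refine hx.2 ?_
  rw [← h₁, mem_interior_iff_mem_nhds]
  filter_upwards [ho.mem_nhds hxΩ, isClosed_closure.isOpen_compl.mem_nhds h2] with y hy hy2
  have : y ∈ closure Ω₁ ∪ closure Ω₂ := hcl ▸ subset_closure hy
  exact this.resolve_right hy2

/-- A flux that vanishes on the outer boundary leaves through the interface. -/
theorem IsMesh.sum_flux_eq_interface (hd : 2 ≤ d) (h : IsMesh T Ω₁) (hΩ : interior (closure Ω) = Ω)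
    (hcl : closure Ω = closure Ω₁ ∪ closure Ω₂) (hdis : Disjoint Ω₁ Ω₂) {F : Pt d → Pt d}
    (hF : IntegrableOn F (skeleton T) (surface d))
    (h0 : ∀ᵐ x ∂((surface d).restrict (frontier Ω₁ ∩ frontier Ω)),
      inner ℝ (F x) (outwardNormal Ω₁ x) = 0) :
    ∑ K ∈ T, ∫ x in bdry K, inner ℝ (F x) (cellNormal K x) ∂(surface d) =
      ∫ x in closure Ω₁ ∩ closure Ω₂, inner ℝ (F x) (outwardNormal Ω₁ x) ∂(surface d) := by
  rw [h.sum_flux hd hF]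
  refine setIntegral_eq_of_subset_of_ae_sdiff_eq_zero
    isClosed_frontier.measurableSet.nullMeasurableSet (interface_subset_frontier h.isOpen hdis) ?_
  rw [ae_restrict_iff' (isClosed_frontier.inter isClosed_frontier).measurableSet] at h0
  filter_upwards [h0] with x hx hx1
  exact hx ((frontier_subset_interface h.regular hΩ hcl hx1.1).resolve_left hx1.2)

end Interface

/-! ### Strain tensors and integration by parts on a cell -/

theorem strain_apply {d : ℕ} (A : Matrix (Fin d) (Fin d) ℝ) (i j : Fin d) :
    strain A i j = (A i j + A j i) / 2 := by
  simp only [strain, Matrix.smul_apply, Matrix.add_apply, Matrix.transpose_apply, smul_eq_mul]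
  ring

/-- A symmetric matrix does not see the antisymmetric part of the other factor. Only plain entries
of `B` remain, so that Green's formula applies entry by entry. -/
theorem ddot_strain {d : ℕ} (A B : Matrix (Fin d) (Fin d) ℝ) :
    ddot (strain A) (strain B) = ∑ i, ∑ j, (A i j * B i j + A j i * B i j) / 2 := by
  have h : ∑ i, ∑ j, (A i j + A j i) / 4 * B j i = ∑ i, ∑ j, (A i j + A j i) / 4 * B i j := by
    rw [Finset.sum_comm]
    exact Finset.sum_congr rfl fun i _ => Finset.sum_congr rfl fun j _ => by ring
  calc ddot (strain A) (strain B)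
      = ∑ i, ∑ j, (A i j + A j i) / 4 * B i j + ∑ i, ∑ j, (A i j + A j i) / 4 * B j i := by
        simp only [ddot, strain_apply, ← Finset.sum_add_distrib]
        exact Finset.sum_congr rfl fun i _ => Finset.sum_congr rfl fun j _ => by ring
    _ = _ := by
        rw [h]
        simp only [← Finset.sum_add_distrib]
        exact Finset.sum_congr rfl fun i _ => Finset.sum_congr rfl fun j _ => by ring

theorem matVec_strain_apply {d : ℕ} (A : Matrix (Fin d) (Fin d) ℝ) (v : Pt d) (i : Fin d) :
    matVec (strain A) v i = ∑ j, (A i j + A j i) / 2 * v j := by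
  simp [matVec, Matrix.mulVec, dotProduct, strain_apply]

theorem inner_matVec_strain {d : ℕ} (A : Matrix (Fin d) (Fin d) ℝ) (v w : Pt d) :
    inner ℝ (matVec (strain A) v) w = ∑ i, ∑ j, (A i j * (w i * v j) + A j i * (w i * v j)) / 2 := by
  simp only [inner_eq_sum, matVec_strain_apply, Finset.sum_mul]
  exact Finset.sum_congr rfl fun i _ => Finset.sum_congr rfl fun j _ => by ring

/-- Symmetry of the strain. It turns the traction tested with `w` into the normal flux of the field
`ε w`, to which the cancellation of fluxes applies. -/
theorem inner_matVec_strain_comm {d : ℕ} (A : Matrix (Fin d) (Fin d) ℝ) (v w : Pt d) :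
    inner ℝ (matVec (strain A) v) w = inner ℝ (matVec (strain A) w) v := by
  rw [inner_matVec_strain, inner_matVec_strain, Finset.sum_comm]
  exact Finset.sum_congr rfl fun i _ => Finset.sum_congr rfl fun j _ => by ring

theorem integrable_matVec_strain {d : ℕ} {μ : Measure (Pt d)}
    {A : Pt d → Matrix (Fin d) (Fin d) ℝ} {w : Pt d → Pt d}
    (hA : ∀ i j, MemLp (fun x => A x i j) 2 μ) (hw : ∀ i, MemLp (fun x => w x i) 2 μ) :
    Integrable (fun x => matVec (strain (A x)) (w x)) μ := by
  refine Integrable.of_eval_piLp fun i => ?_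
  simp only [matVec_strain_apply]
  refine integrable_finsetSum _ fun j _ => ?_
  have h := ((hA i j).integrable_mul (hw j)).add ((hA j i).integrable_mul (hw j))
  refine (h.div_const 2).congr (Eventually.of_forall fun x => ?_)
  simp only [Pi.add_apply, Pi.mul_apply]
  ring

theorem integrable_smul_of_memLp {d : ℕ} {μ : Measure (Pt d)} {q : Pt d → ℝ} {w : Pt d → Pt d}
    (hq : MemLp q 2 μ) (hw : ∀ i, MemLp (fun x => w x i) 2 μ) :
    Integrable (fun x => q x • w x) μ :=
  Integrable.of_eval_piLp fun i => hq.integrable_mul (hw i)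

theorem integral_sum_sum_add_div {d : ℕ} {μ : Measure (Pt d)} {F G : Fin d → Fin d → Pt d → ℝ}
    (hF : ∀ i j, Integrable (F i j) μ) (hG : ∀ i j, Integrable (G i j) μ) :
    ∫ x, ∑ i, ∑ j, (F i j x + G i j x) / 2 ∂μ =
      ∑ i, ∑ j, ((∫ x, F i j x ∂μ) + ∫ x, G i j x ∂μ) / 2 := by
  have h (i j : Fin d) : Integrable (fun x => (F i j x + G i j x) / 2) μ :=
    ((hF i j).add (hG i j)).div_const 2
  rw [integral_finsetSum _ fun i _ => integrable_finsetSum _ fun j _ => h i j]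
  refine Finset.sum_congr rfl fun i _ => ?_
  rw [integral_finsetSum _ fun j _ => h i j]
  refine Finset.sum_congr rfl fun j _ => ?_
  rw [integral_div, integral_add (hF i j) (hG i j)]

section Cell

variable {d : ℕ} {T : Finset (Finset (Pt d))} {Ω : Set (Pt d)} {K : Finset (Pt d)}

theorem integral_trace_jacobian (hd : 2 ≤ d) (h : IsMesh T Ω) (hK : K ∈ T) {p : Pt d → ℝ}
    {Dp : Pt d → Fin d → ℝ} {pT : Pt d → ℝ} (hp : IsH1 Ω p Dp)
    (hT : IsTrace Ω (skeleton T) p Dp pT) {v : Pt d → Pt d}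
    (hv : ∀ i, ContDiff ℝ 1 fun x => v x i) :
    -(∫ x in cell K, p x * (jacobian v x).trace) +
        ∫ x in bdry K, pT x * inner ℝ (v x) (cellNormal K x) ∂(surface d) =
      ∫ x in cell K, ∑ i, Dp x i * v x i := by
  have hμ := h.volume_restrict_cell_le hK
  have hs : (surface d).restrict (bdry K) ≤ (surface d).restrict (skeleton T) :=
    Measure.restrict_mono_set _ (bdry_subset_skeleton hK)
  have hpd (i : Fin d) : Continuous (partialDeriv i fun x => v x i) :=
    ((hv i).continuous_fderiv one_ne_zero).clm_apply continuous_const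
  have i1 (i : Fin d) : IntegrableOn (fun x => p x * partialDeriv i (fun x => v x i) x) (cell K) :=
    (hp.memLp.mono_measure hμ).integrable_mul (memLp_cell_of_continuous K (hpd i))
  have i2 (i : Fin d) : IntegrableOn (fun x => Dp x i * v x i) (cell K) :=
    ((hp.memLp_grad i).mono_measure hμ).integrable_mul
      (memLp_cell_of_continuous K (hv i).continuous)
  have i3 (i : Fin d) : IntegrableOn (fun x => pT x * (v x i * cellNormal K x i)) (bdry K)
      (surface d) :=
    (hT.1.mono_measure hs).integrable_mul
      (memLp_mul_cellNormal hd h hK (memLp_bdry_of_continuous hd h hK (hv i).continuous) i)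
  have e1 (x : Pt d) : p x * (jacobian v x).trace =
      ∑ i, p x * partialDeriv i (fun x => v x i) x := by
    simp [Matrix.trace, jacobian, Finset.mul_sum]
  have e2 (x : Pt d) : pT x * inner ℝ (v x) (cellNormal K x) =
      ∑ i, pT x * (v x i * cellNormal K x i) := by
    rw [inner_eq_sum, Finset.mul_sum]
  simp only [e1, e2]
  rw [integral_finsetSum _ fun i _ => i1 i, integral_finsetSum _ fun i _ => i2 i,
    integral_finsetSum _ fun i _ => i3 i, ← Finset.sum_neg_distrib, ← Finset.sum_add_distrib]
  refine Finset.sum_congr rfl fun i _ => ?_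
  rw [← green hd h hK hp hT (hv i) i]
  ring

theorem integral_ddot_strain (hd : 2 ≤ d) (h : IsMesh T Ω) (hK : K ∈ T)
    {A AT : Pt d → Matrix (Fin d) (Fin d) ℝ} {H : Pt d → Fin d → Fin d → Fin d → ℝ}
    (hA : ∀ i j, IsH1 Ω (fun x => A x i j) (fun x => H x i j))
    (hT : ∀ i j, IsTrace Ω (skeleton T) (fun x => A x i j) (fun x => H x i j) (fun x => AT x i j))
    {v : Pt d → Pt d} (hv : ∀ i, ContDiff ℝ 1 fun x => v x i) :
    ∫ x in cell K, ddot (strain (A x)) (strain (jacobian v x)) =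
      -(∫ x in cell K, ∑ i, divStrain (H x) i * v x i) +
        ∫ x in bdry K, inner ℝ (matVec (strain (AT x)) (cellNormal K x)) (v x) ∂(surface d) := by
  have hμ := h.volume_restrict_cell_le hK
  have hs : (surface d).restrict (bdry K) ≤ (surface d).restrict (skeleton T) :=
    Measure.restrict_mono_set _ (bdry_subset_skeleton hK)
  have hpd (i j : Fin d) : Continuous (partialDeriv j fun x => v x i) :=
    ((hv i).continuous_fderiv one_ne_zero).clm_apply continuous_const
  have i1 (a b i j : Fin d) : Integrable (fun x => A x a b * partialDeriv j (fun x => v x i) x)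
      (volume.restrict (cell K)) :=
    ((hA a b).memLp.mono_measure hμ).integrable_mul (memLp_cell_of_continuous K (hpd i j))
  have i2 (a b i j : Fin d) : Integrable (fun x => H x a b j * v x i)
      (volume.restrict (cell K)) :=
    (((hA a b).memLp_grad j).mono_measure hμ).integrable_mul
      (memLp_cell_of_continuous K (hv i).continuous)
  have i3 (a b i j : Fin d) : Integrable (fun x => AT x a b * (v x i * cellNormal K x j))
      ((surface d).restrict (bdry K)) :=
    ((hT a b).1.mono_measure hs).integrable_mul
      (memLp_mul_cellNormal hd h hK (memLp_bdry_of_continuous hd h hK (hv i).continuous) j)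
  have e1 (x : Pt d) : ddot (strain (A x)) (strain (jacobian v x)) =
      ∑ i, ∑ j, (A x i j * partialDeriv j (fun x => v x i) x +
        A x j i * partialDeriv j (fun x => v x i) x) / 2 := ddot_strain _ _
  have e2 (x : Pt d) : ∑ i, divStrain (H x) i * v x i =
      ∑ i, ∑ j, (H x i j j * v x i + H x j i j * v x i) / 2 := by
    simp only [divStrain, Finset.sum_mul]
    exact Finset.sum_congr rfl fun i _ => Finset.sum_congr rfl fun j _ => by ring
  have s1 : ∫ x in cell K, ddot (strain (A x)) (strain (jacobian v x)) =
      ∑ i, ∑ j, ((∫ x in cell K, A x i j * partialDeriv j (fun x => v x i) x) +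
        ∫ x in cell K, A x j i * partialDeriv j (fun x => v x i) x) / 2 := by
    simp only [e1]
    exact integral_sum_sum_add_div (fun i j => i1 i j i j) (fun i j => i1 j i i j)
  have s2 : ∫ x in cell K, ∑ i, divStrain (H x) i * v x i =
      ∑ i, ∑ j, ((∫ x in cell K, H x i j j * v x i) + ∫ x in cell K, H x j i j * v x i) / 2 := by
    simp only [e2]
    exact integral_sum_sum_add_div (fun i j => i2 i j i j) (fun i j => i2 j i i j)
  have s3 : ∫ x in bdry K, inner ℝ (matVec (strain (AT x)) (cellNormal K x)) (v x) ∂(surface d) =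
      ∑ i, ∑ j, ((∫ x in bdry K, AT x i j * (v x i * cellNormal K x j) ∂(surface d)) +
        ∫ x in bdry K, AT x j i * (v x i * cellNormal K x j) ∂(surface d)) / 2 := by
    simp only [inner_matVec_strain]
    exact integral_sum_sum_add_div (fun i j => i3 i j i j) (fun i j => i3 j i i j)
  rw [s1, s2, s3, ← Finset.sum_neg_distrib, ← Finset.sum_add_distrib]
  refine Finset.sum_congr rfl fun i _ => ?_
  rw [← Finset.sum_neg_distrib, ← Finset.sum_add_distrib]
  refine Finset.sum_congr rfl fun j _ => ?_
  rw [← green hd h hK (hA i j) (hT i j) (hv i) j, ← green hd h hK (hA j i) (hT j i) (hv i) j]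
  ring

end Cell

/-! ### The momentum equations on a single cell -/

section Momentum

variable {d : ℕ} {G : MeshedDomain d} {c : Params} {S : Fields d} {f : Pt d → Pt d}
  {g : Pt d → ℝ} {K : Finset (Pt d)} {v vbar : Pt d → Pt d}

/-- After integration by parts the volume terms combine to the left side of the momentum equation,
and the traction tested with `v` cancels. The traction tested with `vbar` is left over, written as a
normal flux. -/
theorem stokes_cell (hd : 2 ≤ d) (hG : G.IsAdmissible) (hsm : S.IsSmooth G)
    (htr : S.HasTraces G) (hst : S.SolvesStokes c G f) (hK : K ∈ G.Ts)
    (hv : ∀ i, ContDiff ℝ 1 fun x => v x i)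
    (hvb : ∀ i, MemLp (fun x => vbar x i) 2 ((surface d).restrict (skeleton G.Ts))) :
    (∫ x in cell K, 2 * c.mu * ddot (strain (S.Du x)) (strain (jacobian v x)))
      - (∫ x in bdry K, 2 * c.mu * inner ℝ (matVec (strain (S.DusT x)) (cellNormal K x))
          (v x - vbar x) ∂(surface d))
      + (-(∫ x in cell K, S.p x * (jacobian v x).trace)
        + ∫ x in bdry K, S.psT x * inner ℝ (v x) (cellNormal K x) ∂(surface d)) =
    (∫ x in cell K, inner ℝ (f x) (v x)) + ∫ x in bdry K,
      inner ℝ ((2 * c.mu) • matVec (strain (S.DusT x)) (vbar x)) (cellNormal K x) ∂(surface d) := by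
  have h := hG.isMesh_s hd
  have hμ := h.volume_restrict_cell_le hK
  have hs : (surface d).restrict (bdry K) ≤ (surface d).restrict (skeleton G.Ts) :=
    Measure.restrict_mono_set _ (bdry_subset_skeleton hK)
  have hint {w : Pt d → Pt d} (hw : ∀ i, MemLp (fun x => w x i) 2 ((surface d).restrict (bdry K))) :
      Integrable (fun x => inner ℝ (matVec (strain (S.DusT x)) (w x)) (cellNormal K x))
        ((surface d).restrict (bdry K)) :=
    h.integrableOn_inner_cellNormal hd hK
      (integrable_matVec_strain (fun i j => (htr.Dus i j).1.mono_measure hs) hw)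
  have h1 := hint fun i => memLp_bdry_of_continuous hd h hK (hv i).continuous
  have h2 := hint fun i => (hvb i).mono_measure hs
  have e1 (x : Pt d) : inner ℝ (matVec (strain (S.DusT x)) (cellNormal K x)) (v x - vbar x) =
      inner ℝ (matVec (strain (S.DusT x)) (v x)) (cellNormal K x) -
        inner ℝ (matVec (strain (S.DusT x)) (vbar x)) (cellNormal K x) := by
    rw [inner_sub_right, inner_matVec_strain_comm _ (cellNormal K x) (v x),
      inner_matVec_strain_comm _ (cellNormal K x) (vbar x)]
  have i1 (i : Fin d) : IntegrableOn (fun x => divStrain (S.D2u x) i * v x i) (cell K) := by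
    refine MemLp.integrable_mul (p := 2) (q := 2) ?_
      (memLp_cell_of_continuous K (hv i).continuous)
    refine memLp_finsetSum _ fun j _ => ?_
    have h3 := (((hsm.Dus i j).memLp_grad j).mono_measure hμ).add
      (((hsm.Dus j i).memLp_grad j).mono_measure hμ)
    refine (h3.mul_const 2⁻¹).ae_eq (Eventually.of_forall fun x => ?_)
    simp [div_eq_mul_inv]
  have i2 (i : Fin d) : IntegrableOn (fun x => S.Dp x i * v x i) (cell K) :=
    ((hsm.ps.memLp_grad i).mono_measure hμ).integrable_mul
      (memLp_cell_of_continuous K (hv i).continuous)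
  have e2 : ∫ x in cell K, inner ℝ (f x) (v x) =
      (∫ x in cell K, ∑ i, S.Dp x i * v x i) -
        2 * c.mu * ∫ x in cell K, ∑ i, divStrain (S.D2u x) i * v x i := by
    rw [← integral_const_mul, ← integral_sub (integrable_finsetSum _ fun i _ => i2 i)
      ((integrable_finsetSum _ fun i _ => i1 i).const_mul _)]
    refine integral_congr_ae ?_
    filter_upwards [ae_mono hμ hst.momentum] with x hx
    simp only [inner_eq_sum, ← hx, Finset.mul_sum, ← Finset.sum_sub_distrib]
    exact Finset.sum_congr rfl fun i _ => by ring
  rw [integral_trace_jacobian hd h hK hsm.ps htr.ps hv, integral_const_mul, integral_const_mul,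
    integral_ddot_strain hd h hK hsm.Dus htr.Dus hv, e2]
  simp only [e1, inner_smul_left, conj_trivial]
  rw [integral_sub h1 h2, integral_const_mul]
  simp only [inner_matVec_strain_comm _ (cellNormal K _) (v _)]
  ring

theorem darcy_cell {T : Finset (Finset (Pt d))} {Ω : Set (Pt d)} (hd : 2 ≤ d) (h : IsMesh T Ω)
    (hK : K ∈ T) {p pT : Pt d → ℝ} {Dp : Pt d → Fin d → ℝ} {u : Pt d → Pt d} {κ : ℝ}
    (hp : IsH1 Ω p Dp) (hT : IsTrace Ω (skeleton T) p Dp pT)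
    (hu : ∀ i, MemLp (fun x => u x i) 2 (volume.restrict Ω))
    (hdarcy : ∀ᵐ x ∂(volume.restrict Ω), ∀ i, κ * u x i + Dp x i = 0)
    (hv : ∀ i, ContDiff ℝ 1 fun x => v x i) :
    (∫ x in cell K, κ * inner ℝ (u x) (v x)) + (-(∫ x in cell K, p x * (jacobian v x).trace)
        + ∫ x in bdry K, pT x * inner ℝ (v x) (cellNormal K x) ∂(surface d)) = 0 := by
  have hμ := h.volume_restrict_cell_le hK
  rw [integral_trace_jacobian hd h hK hp hT hv, ← integral_add]
  · refine integral_eq_zero_of_ae ?_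
    filter_upwards [ae_mono hμ hdarcy] with x hx
    rw [inner_eq_sum, Finset.mul_sum, ← Finset.sum_add_distrib]
    refine Finset.sum_eq_zero fun i _ => ?_
    rw [← mul_assoc, ← add_mul, hx i, zero_mul]
  · simp only [inner_eq_sum]
    exact (integrable_finsetSum _ fun i _ => ((hu i).mono_measure hμ).integrable_mul
      (memLp_cell_of_continuous K (hv i).continuous)).const_mul _
  · exact integrable_finsetSum _ fun i _ => ((hp.memLp_grad i).mono_measure hμ).integrable_mul
      (memLp_cell_of_continuous K (hv i).continuous)

end Momentum

/-! ### The balance of forces on the interface -/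

section Interface

variable {d : ℕ} {G : MeshedDomain d} {c : Params} {S : Fields d} {f : Pt d → Pt d}
  {g : Pt d → ℝ}

theorem MeshedDomain.IsAdmissible.ΓI_subset_frontier_s (hG : G.IsAdmissible) (hd : 2 ≤ d) :
    G.ΓI ⊆ frontier G.Ωs :=
  interface_subset_frontier (hG.isMesh_s hd).isOpen hG.disjoint

theorem MeshedDomain.IsAdmissible.ΓI_subset_frontier_d (hG : G.IsAdmissible) (hd : 2 ≤ d) :
    G.ΓI ⊆ frontier G.Ωd := by
  rw [MeshedDomain.ΓI, Set.inter_comm]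
  exact interface_subset_frontier (hG.isMesh_d hd).isOpen hG.disjoint.symm

theorem measurableSet_ΓI (G : MeshedDomain d) : MeasurableSet G.ΓI :=
  (isClosed_closure.inter isClosed_closure).measurableSet

/-- The unit normals of the two subdomains on the interface. -/
theorem MeshedDomain.IsAdmissible.ae_normal_ΓI (hG : G.IsAdmissible) (hd : 2 ≤ d) :
    ∀ᵐ x ∂((surface d).restrict G.ΓI), ‖outwardNormal G.Ωs x‖ = 1 ∧
      outwardNormal G.Ωd x = -outwardNormal G.Ωs x := by
  rw [ae_restrict_iff' (measurableSet_ΓI G)]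
  filter_upwards [(hG.isMesh_s hd).ae_isGenericPt hd,
    ae_outwardNormal_eq_neg hd (hG.isMesh_s hd) (hG.isMesh_d hd) hG.disjoint] with x hx hx' hxI
  refine ⟨?_, hx' (hG.ΓI_subset_frontier_s hd hxI) (hG.ΓI_subset_frontier_d hd hxI)⟩
  obtain ⟨K, -, ν, -, -, hν, -⟩ :=
    (hG.isMesh_s hd).exists_isOneSidedAt hx (hG.ΓI_subset_frontier_s hd hxI)
  rw [hν.outwardNormal_eq, hν.1]

theorem MeshedDomain.IsAdmissible.sum_flux_s (hG : G.IsAdmissible) (hd : 2 ≤ d) {F : Pt d → Pt d}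
    (hF : IntegrableOn F (skeleton G.Ts) (surface d))
    (h0 : ∀ᵐ x ∂((surface d).restrict G.Γs), inner ℝ (F x) (outwardNormal G.Ωs x) = 0) :
    ∑ K ∈ G.Ts, ∫ x in bdry K, inner ℝ (F x) (cellNormal K x) ∂(surface d) =
      ∫ x in G.ΓI, inner ℝ (F x) (outwardNormal G.Ωs x) ∂(surface d) :=
  (hG.isMesh_s hd).sum_flux_eq_interface hd hG.regular hG.closure_eq hG.disjoint hF h0

theorem MeshedDomain.IsAdmissible.sum_flux_d (hG : G.IsAdmissible) (hd : 2 ≤ d) {F : Pt d → Pt d}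
    (hF : IntegrableOn F (skeleton G.Td) (surface d))
    (h0 : ∀ᵐ x ∂((surface d).restrict G.Γd), inner ℝ (F x) (outwardNormal G.Ωd x) = 0) :
    ∑ K ∈ G.Td, ∫ x in bdry K, inner ℝ (F x) (cellNormal K x) ∂(surface d) =
      ∫ x in G.ΓI, inner ℝ (F x) (outwardNormal G.Ωd x) ∂(surface d) := by
  rw [MeshedDomain.ΓI, Set.inter_comm]
  exact (hG.isMesh_d hd).sum_flux_eq_interface hd hG.regular
    (by rw [hG.closure_eq, Set.union_comm]) hG.disjoint.symm hF h0

theorem MeshedDomain.IsAdmissible.integrableOn_inner_normal (hG : G.IsAdmissible) (hd : 2 ≤ d)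
    {F : Pt d → Pt d} (hF : IntegrableOn F G.ΓI (surface d)) :
    IntegrableOn (fun x => inner ℝ (F x) (outwardNormal G.Ωs x)) G.ΓI (surface d) := by
  refine hF.norm.mono' (hF.aestronglyMeasurable.inner
    (((hG.isMesh_s hd).aestronglyMeasurable_outwardNormal hd).mono_set
      (hG.ΓI_subset_frontier_s hd))) (Eventually.of_forall fun x => ?_)
  exact (norm_inner_le_norm _ _).trans
    (mul_le_of_le_one_right (norm_nonneg _) (norm_outwardNormal_le_one _ _))

theorem MeshedDomain.IsAdmissible.restrict_ΓI_le_s (hG : G.IsAdmissible) (hd : 2 ≤ d) :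
    (surface d).restrict G.ΓI ≤ (surface d).restrict (skeleton G.Ts) :=
  Measure.restrict_mono_set _ ((hG.ΓI_subset_frontier_s hd).trans
    (hG.isMesh_s hd).frontier_subset_skeleton)

theorem MeshedDomain.IsAdmissible.restrict_ΓI_le_d (hG : G.IsAdmissible) (hd : 2 ≤ d) :
    (surface d).restrict G.ΓI ≤ (surface d).restrict (skeleton G.Td) :=
  Measure.restrict_mono_set _ ((hG.ΓI_subset_frontier_d hd).trans
    (hG.isMesh_d hd).frontier_subset_skeleton)

theorem inner_tangential {d : ℕ} {n : Pt d} (hn : ‖n‖ = 1) (a b : Pt d) :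
    inner ℝ (tangential n a) (tangential n b) = inner ℝ a b - inner ℝ a n * inner ℝ b n := by
  simp only [tangential, inner_sub_left, inner_sub_right, inner_smul_left, inner_smul_right,
    conj_trivial, real_inner_self_eq_norm_sq, hn, real_inner_comm b n]
  ring

/-- The balance of forces on the interface, tested with `vbar`. -/
theorem interface_balance (hd : 2 ≤ d) (hG : G.IsAdmissible) (htr : S.HasTraces G)
    (hI : S.SolvesInterface c G) {vbar : Pt d → Pt d}
    (hvb : ∀ i, MemLp (fun x => vbar x i) 2 ((surface d).restrict (skeleton G.Ts))) :
    (∫ x in G.ΓI, inner ℝ ((2 * c.mu) • matVec (strain (S.DusT x)) (vbar x))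
        (outwardNormal G.Ωs x) ∂(surface d))
      + (∫ x in G.ΓI, c.alpha * c.mu * c.kf ^ (-(1 / 2) : ℝ) *
        inner ℝ (tangential (outwardNormal G.Ωs x) (S.usT x))
          (tangential (outwardNormal G.Ωs x) (vbar x)) ∂(surface d))
      + bFormI G G.Ωs S.psT vbar + bFormI G G.Ωd S.pdT vbar = 0 := by
  have hs := hG.restrict_ΓI_le_s hd
  have hd' := hG.restrict_ΓI_le_d hd
  have hvI (i : Fin d) := (hvb i).mono_measure hs
  have i1 : IntegrableOn (fun x => inner ℝ ((2 * c.mu) • matVec (strain (S.DusT x)) (vbar x))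
      (outwardNormal G.Ωs x)) G.ΓI (surface d) := hG.integrableOn_inner_normal hd ((integrable_matVec_strain
    (fun i j => (htr.Dus i j).1.mono_measure hs) hvI).smul (2 * c.mu))
  have i2 := hG.integrableOn_inner_normal hd
    (integrable_smul_of_memLp (htr.ps.1.mono_measure hs) hvI)
  have i3 := hG.integrableOn_inner_normal hd
    (integrable_smul_of_memLp (htr.pd.1.mono_measure hd') hvI)
  have e2 : ∫ x in G.ΓI, c.alpha * c.mu * c.kf ^ (-(1 / 2) : ℝ) *
        inner ℝ (tangential (outwardNormal G.Ωs x) (S.usT x))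
          (tangential (outwardNormal G.Ωs x) (vbar x)) ∂(surface d) =
      ∫ x in G.ΓI, (inner ℝ (S.psT x • vbar x) (outwardNormal G.Ωs x)
        - inner ℝ (S.pdT x • vbar x) (outwardNormal G.Ωs x)
        - inner ℝ ((2 * c.mu) • matVec (strain (S.DusT x)) (vbar x))
          (outwardNormal G.Ωs x)) ∂(surface d) := by
    refine integral_congr_ae ?_
    filter_upwards [hG.ae_normal_ΓI hd, hI.force, hI.slip] with x hx hforce hslip
    -- The slip condition replaces the tangential velocity by the tangential traction. Its product
    -- with `vbar` is the full product minus the normal part, which the force condition expresses by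
    -- the pressure jump.
    rw [← real_inner_smul_left, ← hslip, inner_neg_left, real_inner_smul_left,
      inner_tangential hx.1, inner_matVec_strain_comm _ _ (vbar x)]
    simp only [real_inner_smul_left]
    rw [← hforce]
    ring
  have e3 : bFormI G G.Ωd S.pdT vbar =
      ∫ x in G.ΓI, inner ℝ (S.pdT x • vbar x) (outwardNormal G.Ωs x) ∂(surface d) := by
    rw [bFormI, ← integral_neg]
    refine integral_congr_ae ?_
    filter_upwards [hG.ae_normal_ΓI hd] with x hx
    rw [hx.2, inner_neg_right, real_inner_smul_left]
    ring
  have e4 : bFormI G G.Ωs S.psT vbar =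
      -∫ x in G.ΓI, inner ℝ (S.psT x • vbar x) (outwardNormal G.Ωs x) ∂(surface d) := by
    simp only [bFormI, real_inner_smul_left]
  have i4 : IntegrableOn (fun x => inner ℝ (S.psT x • vbar x) (outwardNormal G.Ωs x)
      - inner ℝ (S.pdT x • vbar x) (outwardNormal G.Ωs x)) G.ΓI (surface d) := i2.sub i3
  rw [e2, e3, e4, integral_sub i4 i1, integral_sub i2 i3]
  ring

end Interface

/-! ### The two discrete equations -/

section Consistency

variable {d k : ℕ} {G : MeshedDomain d} {c : Params} {S : Fields d} {f : Pt d → Pt d}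
  {g : Pt d → ℝ}

theorem interior_cell_nonempty {K : Finset (Pt d)} (hK : K.card = d + 1)
    (hind : AffineIndependent ℝ ((↑) : K → Pt d)) : (interior (cell K)).Nonempty := by
  have htop : affineSpan ℝ (Set.range ((↑) : K → Pt d)) = ⊤ := by
    rw [hind.affineSpan_eq_top_iff_card_eq_finrank_add_one]
    simp [hK]
  rw [cell, interior_convexHull_nonempty_iff_affineSpan_eq_top]
  simpa using htop

/-- A common simplex would have interior points in both subdomains. Consequently the case
distinction in `Fields.velocity` selects the trace `udT` on the cells of `Td`. -/
theorem MeshedDomain.IsAdmissible.notMem_Ts (hG : G.IsAdmissible) (hd : 2 ≤ d)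
    {K : Finset (Pt d)} (hK : K ∈ G.Td) : K ∉ G.Ts := fun hKs => by
  obtain ⟨x, hx⟩ := interior_cell_nonempty (hG.card_eq K (.inr hK)) (hG.indep K (.inr hK))
  exact Set.disjoint_left.1 hG.disjoint ((hG.isMesh_s hd).interior_cell_subset hKs hx)
    ((hG.isMesh_d hd).interior_cell_subset hK hx)

theorem InVbar.inQbar {vbar : Pt d → Pt d} (h : InVbar G k vbar) (i : Fin d) :
    InQbar k G.Ts fun x => vbar x i := fun F hF => by
  obtain ⟨w, hw, hvw⟩ := h.1 F hF
  exact ⟨fun x => w x i, hw i, hvw.mono fun x hx => congrArg (fun y : Pt d => y i) hx⟩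

theorem IsPolyVec.contDiff {v : Pt d → Pt d} (h : IsPolyVec k v) (i : Fin d) :
    ContDiff ℝ 1 fun x => v x i := (h i).contDiff.of_le (by simp)

theorem momentum_equation (hd : 2 ≤ d) (hG : G.IsAdmissible) (hsm : S.IsSmooth G)
    (htr : S.HasTraces G) (hsol : S.SolvesProblem c G f g)
    {v : Finset (Pt d) → Pt d → Pt d} {vbar : Pt d → Pt d} {vm : Finset (Pt d) → Pt d → Pt d}
    (hv : InVh G k v) (hvbar : InVbar G k vbar) (hvm : InVhd G k vm) :
    aForm c G (S.velocity G) (discreteVelocity v vbar vm)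
      + bForm G S.pressure (discreteVelocity v vbar vm) =
      ∑ K ∈ G.Ts, ∫ x in cell K, inner ℝ (f x) (v K x) := by
  have hvb (i : Fin d) := memLp_skeleton hd (hG.isMesh_s hd) (hvbar.inQbar i)
  have eS : aFormS c G (S.velocity G) (discreteVelocity v vbar vm)
      + bFormOn G.Ts S.p S.psT (fun K => jacobian (v K)) v =
      (∑ K ∈ G.Ts, ∫ x in cell K, inner ℝ (f x) (v K x)) + ∫ x in G.ΓI,
        inner ℝ ((2 * c.mu) • matVec (strain (S.DusT x)) (vbar x)) (outwardNormal G.Ωs x)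
          ∂(surface d) := by
    rw [← hG.sum_flux_s (F := fun x => (2 * c.mu) • matVec (strain (S.DusT x)) (vbar x)) hd
      ((integrable_matVec_strain (fun i j => (htr.Dus i j).1) hvb).smul (2 * c.mu)), ← Finset.sum_add_distrib]
    · rw [← Finset.sum_congr rfl fun K hK => stokes_cell hd hG hsm htr hsol.stokes hK
        (hv K (.inl hK)).contDiff hvb]
      -- The symmetrising term, and likewise the penalty in `z2`, contains `u - ū`, which is zero
      -- for the exact solution.
      have z1 : ∑ K ∈ G.Ts, ∫ x in bdry K,
          2 * c.mu * inner ℝ (matVec (strain (jacobian (v K) x)) (cellNormal K x))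
            ((S.velocity G).traceU K x - S.usT x) ∂(surface d) = 0 :=
        Finset.sum_eq_zero fun K hK => by simp [Fields.velocity, hK]
      have z2 : ∑ K ∈ G.Ts, 2 * c.beta * c.mu * (Metric.diam (cell K))⁻¹ *
          ∫ x in bdry K, inner ℝ ((S.velocity G).traceU K x - S.usT x) (v K x - vbar x)
            ∂(surface d) = 0 :=
        Finset.sum_eq_zero fun K hK => by simp [Fields.velocity, hK]
      simp only [aFormS, bFormOn, discreteVelocity]
      simp only [show (S.velocity G).ubar = S.usT from rfl, z1, z2,
        show (S.velocity G).gradU = fun _ => S.Du from rfl,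
        show (S.velocity G).traceGradU = fun _ => S.DusT from rfl, Finset.sum_add_distrib,
        Finset.sum_sub_distrib, Finset.sum_neg_distrib]
      ring
    -- No stress flux leaves through the outer boundary, where `vbar` vanishes.
    · filter_upwards [hvbar.2] with x hx
      have : matVec (strain (S.DusT x)) 0 = 0 := by
        ext i
        simp [matVec_strain_apply]
      simp [hx, this]
  have eD : aFormD c G (S.velocity G) (discreteVelocity v vbar vm)
      + bFormOn G.Td S.p S.pdT (fun K => jacobian (v K)) v = 0 := by
    simp only [aFormD, bFormOn, ← Finset.sum_neg_distrib, ← Finset.sum_add_distrib]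
    exact Finset.sum_eq_zero fun K hK => darcy_cell hd (hG.isMesh_d hd) hK hsm.pd htr.pd
      (fun i => (hsm.ud i).memLp) hsol.dualPorosity.darcy_f (hv K (.inr hK)).contDiff
  have eM : aFormM c G (S.velocity G) (discreteVelocity v vbar vm)
      + bFormOn G.Td S.pm S.pmT (fun K => jacobian (vm K)) vm = 0 := by
    simp only [aFormM, bFormOn, ← Finset.sum_neg_distrib, ← Finset.sum_add_distrib]
    exact Finset.sum_eq_zero fun K hK => darcy_cell hd (hG.isMesh_d hd) hK hsm.pm htr.pm
      (fun i => (hsm.um i).memLp) hsol.dualPorosity.darcy_m (hvm K hK).contDiff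
  have eI := interface_balance hd hG htr hsol.interface hvb
  have hI : aFormI c G (S.velocity G) (discreteVelocity v vbar vm) =
      ∫ x in G.ΓI, c.alpha * c.mu * c.kf ^ (-(1 / 2) : ℝ) *
        inner ℝ (tangential (outwardNormal G.Ωs x) (S.usT x))
          (tangential (outwardNormal G.Ωs x) (vbar x)) ∂(surface d) := rfl
  have hb : bForm G S.pressure (discreteVelocity v vbar vm) =
      (bFormOn G.Ts S.p S.psT (fun K => jacobian (v K)) v + bFormI G G.Ωs S.psT vbar)
      + (bFormOn G.Td S.p S.pdT (fun K => jacobian (v K)) v + bFormI G G.Ωd S.pdT vbar)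
      + bFormOn G.Td S.pm S.pmT (fun K => jacobian (vm K)) vm := rfl
  rw [aForm, hI, hb]
  linarith

theorem memLp_cell_of_isPoly {K : Finset (Pt d)} {q : Pt d → ℝ}
    (h : ∃ w, IsPoly k w ∧ ∀ᵐ x ∂(volume.restrict (cell K)), q x = w x) :
    MemLp q 2 (volume.restrict (cell K)) := by
  obtain ⟨w, hw, hq⟩ := h
  exact (memLp_cell_of_continuous K hw.contDiff.continuous).ae_eq (hq.mono fun x hx => hx.symm)

theorem memLp_trace {Ω : Set (Pt d)} {w : Pt d → Pt d} {Dw : Pt d → Matrix (Fin d) (Fin d) ℝ}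
    (h : ∀ i, IsH1 Ω (fun x => w x i) (fun x => Dw x i)) :
    MemLp (fun x => (Dw x).trace) 2 (volume.restrict Ω) :=
  memLp_finsetSum _ fun i _ => (h i).memLp_grad i

/-- The field is divergence free, and its flux weighted by `qbar` reduces to the interface, where
the form `b_h^{I,s}` subtracts it. -/
theorem mass_s (hd : 2 ≤ d) (hG : G.IsAdmissible)
    (htr : S.HasTraces G) (hst : S.SolvesStokes c G f) {q qbar : Pt d → ℝ}
    (hqbar : InQbar k G.Ts qbar) :
    bFormOn G.Ts q qbar (S.velocity G).gradU (S.velocity G).traceU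
      + bFormI G G.Ωs qbar S.usT = 0 := by
  have h := hG.isMesh_s hd
  have hflux := hG.sum_flux_s hd
    (integrable_smul_of_memLp (memLp_skeleton hd h hqbar) (fun i => (htr.us i).1)) (by
      filter_upwards [hst.boundary] with x hx
      simp [hx])
  simp only [real_inner_smul_left] at hflux
  have h1 : ∑ K ∈ G.Ts, ∫ x in cell K, q x * ((S.velocity G).gradU K x).trace = 0 :=
    Finset.sum_eq_zero fun K hK => integral_eq_zero_of_ae (by
      filter_upwards [ae_mono (h.volume_restrict_cell_le hK) hst.mass] with x hx
      simp [Fields.velocity, hx])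
  have h2 : ∑ K ∈ G.Ts, ∫ x in bdry K, qbar x *
      inner ℝ ((S.velocity G).traceU K x) (cellNormal K x) ∂(surface d) =
      ∑ K ∈ G.Ts, ∫ x in bdry K, qbar x * inner ℝ (S.usT x) (cellNormal K x) ∂(surface d) :=
    Finset.sum_congr rfl fun K hK => by simp [Fields.velocity, hK]
  rw [bFormOn, bFormI, h1, h2, hflux]
  ring

theorem mass_d (hd : 2 ≤ d) (hG : G.IsAdmissible)
    (htr : S.HasTraces G) (hsol : S.SolvesProblem c G f g) {q qbar : Pt d → ℝ}
    (hqbar : InQbar k G.Td qbar) :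
    bFormOn G.Td q qbar (S.velocity G).gradU (S.velocity G).traceU
      + bFormI G G.Ωd qbar S.usT = -∑ K ∈ G.Td, ∫ x in cell K, q x * (S.Du x).trace := by
  have h := hG.isMesh_d hd
  have hflux := hG.sum_flux_d hd
    (integrable_smul_of_memLp (memLp_skeleton hd h hqbar) (fun i => (htr.ud i).1)) (by
      filter_upwards [hsol.dualPorosity.boundary_f] with x hx
      simp [inner_smul_left, hx])
  simp only [real_inner_smul_left] at hflux
  have h2 : ∑ K ∈ G.Td, ∫ x in bdry K, qbar x *
      inner ℝ ((S.velocity G).traceU K x) (cellNormal K x) ∂(surface d) =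
      ∑ K ∈ G.Td, ∫ x in bdry K, qbar x * inner ℝ (S.udT x) (cellNormal K x) ∂(surface d) :=
    Finset.sum_congr rfl fun K hK => by simp [Fields.velocity, hG.notMem_Ts hd hK]
  -- The interface form contains `ū`, the trace from the Stokes side; continuity of the normal
  -- velocity identifies the two fluxes.
  have h3 : ∫ x in G.ΓI, qbar x * inner ℝ (S.udT x) (outwardNormal G.Ωd x) ∂(surface d) =
      ∫ x in G.ΓI, qbar x * inner ℝ (S.usT x) (outwardNormal G.Ωd x) ∂(surface d) := by
    refine integral_congr_ae ?_
    filter_upwards [hG.ae_normal_ΓI hd, hsol.interface.mass] with x hx hm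
    rw [hx.2, inner_neg_right, inner_neg_right, sub_eq_zero.1 hm]
  rw [bFormOn, bFormI, h2, hflux, h3, neg_add_eq_sub, sub_add_eq_add_sub, add_neg_cancel, zero_sub]
  rfl

/-- There is no interface form for `u^m` to cancel the flux; the no-exchange condition makes the
flux itself vanish. -/
theorem mass_m (hd : 2 ≤ d) (hG : G.IsAdmissible)
    (htr : S.HasTraces G) (hsol : S.SolvesProblem c G f g) {q qbar : Pt d → ℝ}
    (hqbar : InQbar k G.Td qbar) :
    bFormOn G.Td q qbar (S.velocity G).gradUm (S.velocity G).traceUm =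
      -∑ K ∈ G.Td, ∫ x in cell K, q x * (S.Dum x).trace := by
  have h := hG.isMesh_d hd
  have hflux := hG.sum_flux_d hd
    (integrable_smul_of_memLp (memLp_skeleton hd h hqbar) (fun i => (htr.um i).1)) (by
      filter_upwards [hsol.dualPorosity.boundary_m] with x hx
      simp [inner_smul_left, hx])
  simp only [real_inner_smul_left] at hflux
  have h3 : ∫ x in G.ΓI, qbar x * inner ℝ (S.umT x) (outwardNormal G.Ωd x) ∂(surface d) = 0 := by
    refine integral_eq_zero_of_ae ?_
    filter_upwards [hG.ae_normal_ΓI hd, hsol.interface.no_exchange] with x hx hm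
    simp [hx.2, hm]
  simp only [bFormOn, Fields.velocity]
  rw [hflux, h3, add_zero]

theorem mass_equation (hd : 2 ≤ d) (hG : G.IsAdmissible) (hsm : S.IsSmooth G)
    (htr : S.HasTraces G) (hsol : S.SolvesProblem c G f g) {q : PressureArg d}
    (hq : InPh G k q) :
    bForm G q (S.velocity G) - cForm c G S.pressure q =
      -∑ K ∈ G.Td, ∫ x in cell K, g x * q.p x := by
  have h := hG.isMesh_d hd
  have hb : bForm G q (S.velocity G) =
      (bFormOn G.Ts q.p q.pbarS (S.velocity G).gradU (S.velocity G).traceU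
        + bFormI G G.Ωs q.pbarS S.usT)
      + (bFormOn G.Td q.p q.pbarD (S.velocity G).gradU (S.velocity G).traceU
        + bFormI G G.Ωd q.pbarD S.usT)
      + bFormOn G.Td q.pm q.pbarM (S.velocity G).gradUm (S.velocity G).traceUm := rfl
  rw [hb, mass_s hd hG htr hsol.stokes hq.pbarS, mass_d hd hG htr hsol hq.pbarD,
    mass_m hd hG htr hsol hq.pbarM, cForm, Finset.mul_sum, zero_add, ← Finset.sum_neg_distrib,
    ← Finset.sum_neg_distrib, ← Finset.sum_neg_distrib, ← Finset.sum_add_distrib,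
    ← Finset.sum_sub_distrib]
  refine Finset.sum_congr rfl fun K hK => ?_
  have hμ := h.volume_restrict_cell_le hK
  have hp := hsm.pd.memLp.mono_measure hμ
  have hpm := hsm.pm.memLp.mono_measure hμ
  have hqp := memLp_cell_of_isPoly (hq.p.1 K (.inr hK))
  have hqm := memLp_cell_of_isPoly (hq.pm.1 K hK)
  have i1 : Integrable (fun x => q.p x * (S.Du x).trace) (volume.restrict (cell K)) :=
    hqp.integrable_mul ((memLp_trace hsm.ud).mono_measure hμ)
  have i2 : Integrable (fun x => q.pm x * (S.Dum x).trace) (volume.restrict (cell K)) :=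
    hqm.integrable_mul ((memLp_trace hsm.um).mono_measure hμ)
  have i3 : Integrable (fun x => c.sigma * c.km * ((S.pm x - S.p x) * (q.pm x - q.p x)))
      (volume.restrict (cell K)) :=
    ((hpm.sub hp).integrable_mul (hqm.sub hqp)).const_mul _
  have i12 : Integrable (fun x => q.p x * (S.Du x).trace + q.pm x * (S.Dum x).trace)
      (volume.restrict (cell K)) := i1.add i2
  -- The two mass balances tested with `q` and `q^m`; their exchange terms add up to the integrand
  -- of `c_h`.
  have e : ∫ x in cell K, g x * q.p x =
      ∫ x in cell K, (q.p x * (S.Du x).trace + q.pm x * (S.Dum x).trace +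
        c.sigma * c.km * ((S.pm x - S.p x) * (q.pm x - q.p x))) := by
    refine integral_congr_ae ?_
    filter_upwards [ae_mono hμ hsol.dualPorosity.mass_f, ae_mono hμ hsol.dualPorosity.mass_m]
      with x hx hx'
    rw [← hx]
    linear_combination (-q.pm x) * hx'
  rw [e, integral_add i12 i3, integral_add i1 i2, integral_const_mul]
  simp only [Fields.pressure]
  ring

end Consistency

end DualPorosityStokes

theorem mainTheorem7 (d : ℕ) (hd : d = 2 ∨ d = 3) (k : ℕ) (hk : 1 ≤ k)
    (c : DualPorosityStokes.Params)
    (hmu : 0 < c.mu) (hkf : 0 < c.kf) (hkm : 0 < c.km) (hsigma : 0 < c.sigma)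
    (G : DualPorosityStokes.MeshedDomain d) (hG : G.IsAdmissible)
    (f : DualPorosityStokes.Pt d → DualPorosityStokes.Pt d) (g : DualPorosityStokes.Pt d → ℝ)
    (S : DualPorosityStokes.Fields d)
    (hsmooth : S.IsSmooth G) (htrace : S.HasTraces G) (hsol : S.SolvesProblem c G f g) :
    DualPorosityStokes.SatisfiesHDG G k c f g (S.velocity G) S.pressure := by
  have hd2 : 2 ≤ d := by omega
  exact ⟨fun v vbar vm hv hvbar hvm => DualPorosityStokes.momentum_equation hd2 hG hsmooth htrace
      hsol hv hvbar hvm,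
    fun q hq => DualPorosityStokes.mass_equation hd2 hG hsmooth htrace hsol hq⟩
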